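/- Let $u_1,\dots,u_n\in\mathbb C$ be pairwise distinct. Consider Fuchsian systems $$\frac{d\Phi}{dz}=\sum_{k=1}^n\frac{A_k}{z-u_k}\,\Phi,\qquad A_k\in \mathrm{Mat}(m,\mathbb C),$$ such that $A_\infty:=-(A_1+\dots+A_n)$ is diagonal and each of $A_1,\dots,A_n,A_\infty$ has pairwise distinct eigenvalues. *Branch cuts.* Fix a direction $d\in\mathbb C\setminus\{0\}$ such that the parallel cuts $\pi_k=\{u_k+td: t\ge 0\}$ satisfy $u_j\notin\pi_k$ for $j\ne k$, a branch of $\log(z-u_k)$ on $\mathbb C\setminus\pi_k$ for each $k$, and a branch of $\log z$ on $\mathbb C\setminus\{td:t\ge0\}$. Put $\Omega=\mathbb C\setminus\bigcup_k\pi_k$. *Levelt solutions.* For a diagonal matrix $\Lambda$, a pair $(\Lambda,R)$ is admissible if $R$ is nilpotent, commutes with $e^{2\pi i\Lambda}$, and maps the $\mu$-eigenspace of $\Lambda$ into the sum of the $(\mu+j)$-eigenspaces, $j=0,1,2,\dots$, for every $\mu$. Let $\mathcal C_0(\Lambda)$ be the group of $G\in GL(m,\mathbb C)$ with $z^{\Lambda}Gz^{-\Lambda}=G_0+zG_1+z^2G_2+\cdots$.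 Fix an ordering $\lambda^{(k)}_1,\dots,\lambda^{(k)}_m$ of the eigenvalues of each $A_k$, $k=1,\dots,n$, and put $\Lambda^{(k)}=\mathrm{diag}(\lambda^{(k)}_1,\dots,\lambda^{(k)}_m)$, $\Lambda^{(\infty)}=A_\infty$. Choose fundamental matrix solutions $\Phi_1,\dots,\Phi_n,\Phi_\infty$ on $\Omega$ of the form $$\Phi_k(z)=\Psi_k(z)\,(z-u_k)^{\Lambda^{(k)}}(z-u_k)^{R^{(k)}}\quad\text{near }u_k,\qquad \Phi_\infty(z)=\Psi_\infty(1/z)\,z^{-\Lambda^{(\infty)}}z^{-R^{(\infty)}}\quad\text{for }\operatorname{Re}(z/d)\ll0,$$ where $\Psi_k$ is analytic at $u_k$ with $\det\Psi_k(u_k)\neq0$, $\Psi_\infty$ is analytic at $0$ with $\Psi_\infty(0)=1$, all pairs $(\Lambda^{(k)},R^{(k)})$, $k=1,\dots,n,\infty$, are admissible, and the powers are defined by the chosen branches. Define the connection matrices $C_k$ by $\Phi_\infty=\Phi_kC_k$ on $\Omega$. The *monodromy data* of the system, with respect to the cuts (with their branches) and the ordering, is the class of the collection $\Lambda^{(1)},R^{(1)},\dots,\Lambda^{(\infty)},R^{(\infty)},C_1,\dots,C_n$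 modulo $$R^{(k)}\mapsto G_k^{-1}R^{(k)}G_k\ (k=1,\dots,n,\infty),\qquad C_k\mapsto G_k^{-1}C_kG_\infty\ (k=1,\dots,n),\qquad G_k\in\mathcal C_0(\Lambda^{(k)}).$$ **Lemma.** Let two such systems, with residue matrices $A_k^{(1)}$ and $A_k^{(2)}$, have the same poles $u_1,\dots,u_n,\infty$ and the same matrix $A_\infty$. Fix branch cuts as above, and an ordering of the eigenvalues of each of $A^{(1)}_1,\dots,A^{(1)}_n$. Then there is an invertible diagonal matrix $D$ with $A^{(2)}_k=D^{-1}A^{(1)}_kD$ for all $k=1,\dots,n$ if and only if the same ordered numbers are the eigenvalues of $A^{(2)}_1,\dots,A^{(2)}_n$ and, with respect to this ordering and these branch cuts, the two systems have the same monodromy data. -/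

import Mathlib

open Matrix Filter Topology

noncomputable section

/-- Fuchsian systems `dΦ/dz = ∑ₖ Aₖ/(z - uₖ) Φ` of order `m` with poles `u₁, …, uₙ, ∞`,
such that every residue matrix `A₁, …, Aₙ, A_∞` has pairwise distinct eigenvalues and
`A_∞ = -(A₁ + ⋯ + Aₙ)` is diagonal. (Over `ℂ`, the characteristic polynomial has `m` roots
counted with multiplicity.) -/
structure FuchsianSystem {n : ℕ} (m : ℕ) (u : Fin n → ℂ) where
  /-- The residue matrices at the finite poles. -/
  A : Fin n → Matrix (Fin m) (Fin m) ℂ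
  distinct : ∀ k, (A k).charpoly.roots.Nodup
  isDiag_inf : (-∑ k, A k).IsDiag
  distinct_inf : Function.Injective (-∑ k, A k).diag

/-- A system of parallel branch cuts between the points `uₖ` and `∞` along a given generic
direction, together with the branches (numbered by integers) of the logarithms of `z - uₖ`
and of `z`. -/
structure BranchCuts {n : ℕ} (u : Fin n → ℂ) where
  /-- The direction of the cuts. -/
  dir : ℂ
  dir_ne_zero : dir ≠ 0
  /-- The direction is generic: no pole lies on the cut that starts at another pole. -/
  generic : ∀ j k, j ≠ k → ∀ t : ℝ, 0 ≤ t → u j ≠ u k + t * dir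
  /-- The number of the branch of `log (z - uₖ)`. -/
  branch : Fin n → ℤ
  /-- The number of the branch of `log z` at infinity. -/
  branchInf : ℤ

namespace BranchCuts

variable {n : ℕ} {u : Fin n → ℂ} (c : BranchCuts u)

/-- The branch cut `πₖ`: the closed ray from `uₖ` in the given direction. -/
def cut (k : Fin n) : Set ℂ := {z | ∃ t : ℝ, 0 ≤ t ∧ z = u k + t * c.dir}

/-- The plane without the cuts. -/
def domain : Set ℂ := {z | ∀ k, z ∉ c.cut k}

/-- The branches, indexed by `p : ℤ`, of the logarithm on the plane cut along the ray from `0`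
in the given direction: `exp (c.clog p w) = w` for `w ≠ 0`, and `c.clog p` is analytic off this
ray. -/
def clog (p : ℤ) (w : ℂ) : ℂ :=
  Complex.log (-w / c.dir) + Complex.log (-c.dir) + 2 * Real.pi * Complex.I * p

/-- The chosen branch of `log (z - uₖ)`, analytic off the cut `πₖ`. -/
def logAt (k : Fin n) (z : ℂ) : ℂ := c.clog (c.branch k) (z - u k)

/-- The chosen branch of `log z = -log z⁻¹`. -/
def logInf (z : ℂ) : ℂ := c.clog c.branchInf z

end BranchCuts

/-- `M` maps each eigenspace `V_μ` of `Λ = diag(l₁, …, lₘ)` into `⨁_{k ≥ 0} V_{μ + k}`.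
Equivalently, `z^Λ M z^{-Λ} = M₀ + z M₁ + z² M₂ + ⋯`, since the entries of the left side are
`z^{lᵢ - lⱼ} Mᵢⱼ`. -/
def RaisesSpectrum {m : ℕ} (l : Fin m → ℂ) (M : Matrix (Fin m) (Fin m) ℂ) : Prop :=
  ∀ i j, M i j ≠ 0 → ∃ k : ℕ, l i = l j + k

/-- `(Λ, R)` with `Λ = diag(l₁, …, lₘ)` is an admissible pair: `R` is nilpotent, commutes with
`e^{2πiΛ}`, and maps each eigenspace `V_μ` of `Λ` into `⨁_{k ≥ 0} V_{μ + k}`. -/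
def IsAdmissiblePair {m : ℕ} (l : Fin m → ℂ) (R : Matrix (Fin m) (Fin m) ℂ) : Prop :=
  IsNilpotent R ∧
    Commute (diagonal fun i => Complex.exp (2 * Real.pi * Complex.I * l i)) R ∧
    RaisesSpectrum l R

/-- The group `𝒞₀(Λ)`, `Λ = diag(l₁, …, lₘ)`, of the invertible `G` such that
`z^Λ G z^{-Λ} = G₀ + z G₁ + z² G₂ + ⋯`. -/
def groupC0 {m : ℕ} (l : Fin m → ℂ) : Set (GL (Fin m) ℂ) :=
  {G | RaisesSpectrum l (G : Matrix (Fin m) (Fin m) ℂ)}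

/-- A collection `Λ⁽¹⁾, R⁽¹⁾, …, Λ⁽ⁿ⁾, R⁽ⁿ⁾, Λ^(∞), R^(∞), C₁, …, Cₙ`; the diagonal matrices
`Λ` are recorded by their ordered diagonals. -/
structure MonodromyCollection (n m : ℕ) where
  /-- The exponents at the finite poles. -/
  lam : Fin n → Fin m → ℂ
  /-- The nilpotent parts at the finite poles. -/
  R : Fin n → Matrix (Fin m) (Fin m) ℂ
  /-- The exponents at infinity. -/
  lamInf : Fin m → ℂ
  /-- The nilpotent part at infinity. -/
  RInf : Matrix (Fin m) (Fin m) ℂ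
  /-- The connection matrices. -/
  C : Fin n → Matrix (Fin m) (Fin m) ℂ

/-- Equivalence of collections: the ordered exponents agree, and
`R⁽ᵏ⁾ ↦ Gₖ⁻¹ R⁽ᵏ⁾ Gₖ` for `k = 1, …, n, ∞`, `Cₖ ↦ Gₖ⁻¹ Cₖ G_∞` for `k = 1, …, n`, where
`Gₖ ∈ 𝒞₀(Λ⁽ᵏ⁾)` and `G_∞ ∈ 𝒞₀(Λ^(∞))`. -/
def MonodromyCollection.Equivalent {n m : ℕ} (d d' : MonodromyCollection n m) : Prop :=
  ∃ (G : Fin n → GL (Fin m) ℂ) (GInf : GL (Fin m) ℂ),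
    (∀ k, G k ∈ groupC0 (d.lam k)) ∧ GInf ∈ groupC0 d.lamInf ∧
    d'.lam = d.lam ∧ d'.lamInf = d.lamInf ∧
    (∀ k, d'.R k = ((G k)⁻¹).val * d.R k * (G k).val) ∧
    d'.RInf = (GInf⁻¹).val * d.RInf * GInf.val ∧
    (∀ k, d'.C k = ((G k)⁻¹).val * d.C k * GInf.val)

namespace FuchsianSystem

variable {n m : ℕ} {u : Fin n → ℂ} (S : FuchsianSystem m u)

/-- The residue matrix at infinity. -/
def AInf : Matrix (Fin m) (Fin m) ℂ := -∑ k, S.A k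

/-- `lam k 1, …, lam k m` are the eigenvalues of `Aₖ`, in some order, for each `k`. -/
def IsEigenvalueOrdering (lam : Fin n → Fin m → ℂ) : Prop :=
  ∀ k, (S.A k).charpoly.roots = Finset.univ.val.map (lam k)

/-- `Φ` is a fundamental matrix solution, on the plane without the cuts, of
`dΦ/dz = ∑ₖ Aₖ/(z - uₖ) Φ`. -/
def IsFundamental (c : BranchCuts u) (Φ : ℂ → Matrix (Fin m) (Fin m) ℂ) : Prop :=
  (∀ z ∈ c.domain, ∀ i j,
    HasDerivAt (fun w => Φ w i j) (((∑ k, (z - u k)⁻¹ • S.A k) * Φ z) i j) z) ∧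
  ∀ z ∈ c.domain, (Φ z).det ≠ 0

/-- `Φ` is a Levelt fundamental matrix at `uₖ` with data `Λ = diag(l₁, …, lₘ)`, `R`:
near `uₖ`, `Φ(z) = Ψ(z) (z - uₖ)^Λ (z - uₖ)^R` with `Ψ` analytic at `uₖ` and
`det Ψ(uₖ) ≠ 0`. -/
def IsLeveltAt (c : BranchCuts u) (k : Fin n) (l : Fin m → ℂ)
    (R : Matrix (Fin m) (Fin m) ℂ) (Φ : ℂ → Matrix (Fin m) (Fin m) ℂ) : Prop :=
  S.IsFundamental c Φ ∧ IsAdmissiblePair l R ∧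
  ∃ Ψ : ℂ → Matrix (Fin m) (Fin m) ℂ,
    (∀ i j, AnalyticAt ℂ (fun z => Ψ z i j) (u k)) ∧ (Ψ (u k)).det ≠ 0 ∧
    ∀ᶠ z in 𝓝[c.domain] (u k),
      Φ z = Ψ z * NormedSpace.exp (c.logAt k z • diagonal l) * NormedSpace.exp (c.logAt k z • R)

/-- `Φ` is the normalized Levelt fundamental matrix at infinity with data
`Λ = diag(l₁, …, lₘ)`, `R`: near infinity, `Φ(z) = (1 + O(1/z)) z^{-Λ} z^{-R}`, where the first
factor is an analytic function of `1/z`. The plane without the cuts is in general disconnected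
near infinity, where the chosen branch of `log z` is used on the side opposite to the
cuts; elsewhere `Φ` is the analytic continuation. -/
def IsLeveltInf (c : BranchCuts u) (l : Fin m → ℂ)
    (R : Matrix (Fin m) (Fin m) ℂ) (Φ : ℂ → Matrix (Fin m) (Fin m) ℂ) : Prop :=
  S.IsFundamental c Φ ∧ IsAdmissiblePair l R ∧
  ∃ Ψ : ℂ → Matrix (Fin m) (Fin m) ℂ,
    (∀ i j, AnalyticAt ℂ (fun w => Ψ w i j) 0) ∧ Ψ 0 = 1 ∧
    ∃ r : ℝ, ∀ z : ℂ, (z / c.dir).re < -r →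
      Φ z = Ψ z⁻¹ * NormedSpace.exp (-c.logInf z • diagonal l) *
        NormedSpace.exp (-c.logInf z • R)

/-- The collection `d` is read off Levelt fundamental matrices of the system: `Φ₁, …, Φₙ` at
the finite poles and the normalized `Φ_∞` at infinity (where `Λ^(∞) = A_∞`), with the
connection matrices `Cₖ` given by `Φ_∞ = Φₖ Cₖ`. -/
def Realizes (c : BranchCuts u) (d : MonodromyCollection n m) : Prop :=
  d.lamInf = S.AInf.diag ∧
  ∃ (Φ : Fin n → ℂ → Matrix (Fin m) (Fin m) ℂ) (ΦInf : ℂ → Matrix (Fin m) (Fin m) ℂ),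
    (∀ k, S.IsLeveltAt c k (d.lam k) (d.R k) (Φ k)) ∧
    S.IsLeveltInf c d.lamInf d.RInf ΦInf ∧
    ∀ k, ∀ z ∈ c.domain, ΦInf z = Φ k z * d.C k

/-- The monodromy data of the system with respect to the branch cuts `c` and the ordering `lam`
of the eigenvalues of `A₁, …, Aₙ`: the equivalence class of the collections read off the
system. -/
def monodromyData (c : BranchCuts u) (lam : Fin n → Fin m → ℂ) :
    Set (MonodromyCollection n m) :=
  {d | ∃ d₀ : MonodromyCollection n m, d₀.lam = lam ∧ S.Realizes c d₀ ∧ d₀.Equivalent d}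

end FuchsianSystem

end

/-! Suppose first that `A⁽²⁾ₖ = D⁻¹A⁽¹⁾ₖD` with `D` diagonal. Then `D⁻¹Φₖ` and `D⁻¹Φ_∞D` are Levelt
solutions of the second system. The resulting change `R^(∞) ↦ D⁻¹R^(∞)D`, `Cₖ ↦ CₖD` is absorbed by
the gauge freedom at infinity, because every diagonal matrix lies in `𝒞₀(Λ^(∞))`. This is
`monodromyData_subset_of_conj`, used in both directions.

Conversely, let the two classes agree. Equality of classes is informative only if they are nonempty,
so Levelt solutions must be constructed (`exists_realizes`). A global fundamental matrix is glued
from Picard solutions on convex pieces (`exists_isFundamental`). The Levelt form at each pole comes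
from a formal recursion in which resonant terms are put into `R` (`exists_formal_normal_form`), and
a majorant estimate makes the series converge (`exists_local_levelt`).

Given equivalent collections, consider `Q = Φ_∞⁽²⁾ G_∞ (Φ_∞⁽¹⁾)⁻¹`. The relation `Cₖ⁽²⁾G_∞ =
GₖCₖ⁽¹⁾` turns it into `Φₖ⁽²⁾ Gₖ (Φₖ⁽¹⁾)⁻¹`. There the multivalued factors cancel, up to `(z - uₖ)^Λ
Gₖ (z - uₖ)^(-Λ)`, which is polynomial in `z - uₖ` (`levelt_quotient`). So `Q` is analytic at each
`uₖ`, hence across each cut, and in the same way it is analytic in `1/z` at infinity. By Liouville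
`Q` is a constant (`quotient_eq_const`), and it is diagonal because `A_∞` has distinct entries.
Comparing the two differential equations and their residues gives `A⁽²⁾ₖQ = QA⁽¹⁾ₖ`, so `D = Q⁻¹`.
-/

noncomputable section

/-! ### Holomorphic linear differential equations on convex sets. -/

section LinearODE

variable {E : Type*} [NormedAddCommGroup E] [NormedSpace ℂ E]

/-- A differentiable function on a convex open set has a primitive vanishing at a given point. -/
theorem Convex.exists_primitive_eq_zero [CompleteSpace E] {U : Set ℂ} (hU : IsOpen U) (hc : Convex ℝ U)
    {f : ℂ → E} (hf : DifferentiableOn ℂ f U) (b : ℂ) :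
    ∃ g : ℂ → E, g b = 0 ∧ ∀ z ∈ U, HasDerivAt g (f z) z := by
  obtain ⟨g, hg⟩ := hc.exists_forall_hasDerivWithinAt hf
  refine ⟨fun z => g z - g b, sub_self _, fun z hz => ?_⟩
  exact ((hg z hz).hasDerivAt (hU.mem_nhds hz)).sub_const _

/-- One step of the Picard iteration preserves factorial bounds along segments. -/
theorem norm_le_of_hasDerivAt_segment {b z : ℂ} {g g' : ℂ → E} {c D : ℝ} {n : ℕ}
    (hD : ‖z - b‖ ≤ D) (hgb : g b = 0)
    (hg : ∀ t ∈ Set.Icc (0 : ℝ) 1, HasDerivAt g (g' (b + t * (z - b))) (b + t * (z - b)))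
    (hg' : ∀ t ∈ Set.Icc (0 : ℝ) 1, ‖g' (b + t * (z - b))‖ ≤ c * t ^ n / n.factorial) :
    ∀ t ∈ Set.Icc (0 : ℝ) 1, ‖g (b + t * (z - b))‖ ≤ c * D * t ^ (n + 1) / (n + 1).factorial := by
  have hd : ∀ t ∈ Set.Icc (0 : ℝ) 1, HasDerivAt (fun t : ℝ => g (b + t * (z - b)))
      ((z - b) • g' (b + t * (z - b))) t := by
    intro t ht
    have h1 : HasDerivAt (fun t : ℝ => b + (t : ℂ) * (z - b)) (z - b) t := by
      simpa using ((Complex.ofRealCLM.hasDerivAt (x := t)).mul_const (z - b)).const_add b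
    exact (hg t ht).scomp t h1
  have hB : ∀ t : ℝ, HasDerivAt (fun t : ℝ => c * D * t ^ (n + 1) / (n + 1).factorial)
      (c * D * t ^ n / n.factorial) t := by
    intro t
    have := ((hasDerivAt_pow (n + 1) t).const_mul (c * D)).div_const ((n + 1).factorial : ℝ)
    refine this.congr_deriv ?_
    rw [Nat.factorial_succ]
    have : (n.factorial : ℝ) ≠ 0 := by positivity
    push_cast
    field_simp
  refine image_norm_le_of_norm_deriv_right_le_deriv_boundary
    (fun t ht => (hd t ht).continuousAt.continuousWithinAt)
    (fun t ht => (hd t ⟨ht.1, ht.2.le⟩).hasDerivWithinAt) (by simp [hgb]) hB ?_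
  intro t ht
  have h0 := hg' t ⟨ht.1, ht.2.le⟩
  rw [norm_smul]
  calc ‖z - b‖ * ‖g' (b + t * (z - b))‖ ≤ D * (c * t ^ n / n.factorial) := by
        gcongr
        exact (norm_nonneg _).trans hD
    _ = c * D * t ^ n / n.factorial := by ring

/-- Existence of solutions of holomorphic linear differential equations on convex open sets. -/
theorem exists_hasDerivAt_linear [CompleteSpace E] {U : Set ℂ} (hU : IsOpen U) (hc : Convex ℝ U)
    {L : ℂ → E →L[ℂ] E} (hL : DifferentiableOn ℂ L U) {b : ℂ} (hb : b ∈ U) (y : E) :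
    ∃ f : ℂ → E, f b = y ∧ ∀ z ∈ U, HasDerivAt f (L z (f z)) z := by
  -- Holomorphy is kept inside the existential so that `choose` yields a step defined on all
  -- functions, which can then be iterated.
  have hstep : ∀ f : ℂ → E, ∃ g : ℂ → E, DifferentiableOn ℂ f U →
      g b = 0 ∧ ∀ z ∈ U, HasDerivAt g (L z (f z)) z := by
    intro f
    by_cases hf : DifferentiableOn ℂ f U
    · obtain ⟨g, hg⟩ := hc.exists_primitive_eq_zero hU (hL.clm_apply hf) b
      exact ⟨g, fun _ => hg⟩
    · exact ⟨0, fun h => absurd h hf⟩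
  choose step hstep using hstep
  -- These are the increments of the Picard iteration, `P₀ = y` and `Pₙ₊₁ = ∫ L Pₙ` from `b`; the
  -- solution is their sum.
  let P : ℕ → ℂ → E := fun n => Nat.rec (fun _ => y) (fun _ f => step f) n
  have hP : ∀ n, DifferentiableOn ℂ (P n) U := by
    intro n
    induction n with
    | zero => exact differentiableOn_const _
    | succ n ih => exact fun z hz => ((hstep _ ih).2 z hz).differentiableAt.differentiableWithinAt
  have hP0 : ∀ n, P (n + 1) b = 0 := fun n => (hstep _ (hP n)).1
  have hPd : ∀ n, ∀ z ∈ U, HasDerivAt (P (n + 1)) (L z (P n z)) z := fun n => (hstep _ (hP n)).2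
  refine ⟨fun z => ∑' n, P n z, ?_, ?_⟩
  · simp only
    rw [tsum_eq_single 0]
    · rfl
    · intro n hn
      obtain ⟨k, rfl⟩ := Nat.exists_eq_succ_of_ne_zero hn
      exact hP0 k
  intro z₀ hz₀
  obtain ⟨ε, hε, hεU⟩ := Metric.nhds_basis_closedBall.mem_iff.1 (hU.mem_nhds hz₀)
  -- A compact parameter space for all segments from `b` to the ball. The estimate of `Pₙ₊₁` at an
  -- endpoint uses `Pₙ` on the whole segment, so the bounds must hold along segments.
  set S : Set (ℝ × ℂ) := Set.Icc (0 : ℝ) 1 ×ˢ Metric.closedBall z₀ ε with hS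
  have hseg : ∀ p ∈ S, b + (p.1 : ℂ) * (p.2 - b) ∈ U := by
    intro p hp
    have := hc.add_smul_sub_mem hb (hεU hp.2) hp.1
    simpa using this
  obtain ⟨M, hM⟩ : ∃ M, ∀ p ∈ S, ‖L (b + (p.1 : ℂ) * (p.2 - b))‖ ≤ M := by
    apply (isCompact_Icc.prod (isCompact_closedBall z₀ ε)).exists_bound_of_continuousOn
    exact hL.continuousOn.comp (by fun_prop) hseg
  have hM0 : 0 ≤ M := (norm_nonneg _).trans (hM (0, z₀) ⟨by simp, by simp [hε.le]⟩)
  set D := ‖z₀ - b‖ + ε with hDdef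
  have hD : ∀ z ∈ Metric.closedBall z₀ ε, ‖z - b‖ ≤ D := by
    intro z hz
    calc ‖z - b‖ = ‖(z₀ - b) + (z - z₀)‖ := by congr 1; ring
      _ ≤ _ := (norm_add_le _ _).trans (add_le_add_right (by simpa [dist_eq_norm] using hz) _)
  have hbound : ∀ n, ∀ z ∈ Metric.closedBall z₀ ε, ∀ t ∈ Set.Icc (0 : ℝ) 1,
      ‖P n (b + t * (z - b))‖ ≤ ‖y‖ * (M * D) ^ n * t ^ n / n.factorial := by
    intro n
    induction n with
    | zero => intro z hz t ht; simp [P]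
    | succ n ih =>
      intro z hz t ht
      have := norm_le_of_hasDerivAt_segment (g := P (n + 1)) (g' := fun z => L z (P n z))
        (c := M * (‖y‖ * (M * D) ^ n)) (n := n) (hD z hz) (hP0 n)
        (fun t ht => hPd n _ (hseg (t, z) ⟨ht, hz⟩)) (fun t ht => ?_) t ht
      · refine this.trans (le_of_eq ?_)
        ring
      · calc ‖L (b + t * (z - b)) (P n (b + t * (z - b)))‖
            ≤ M * (‖y‖ * (M * D) ^ n * t ^ n / n.factorial) :=
              (ContinuousLinearMap.le_opNorm _ _).trans
                (mul_le_mul (hM (t, z) ⟨ht, hz⟩) (ih z hz t ht) (norm_nonneg _) hM0)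
          _ = _ := by ring
  have hbound' : ∀ n, ∀ z ∈ Metric.closedBall z₀ ε,
      ‖P n z‖ ≤ ‖y‖ * ((M * D) ^ n / n.factorial) := by
    intro n z hz
    have := hbound n z hz 1 (by simp)
    simpa [mul_div_assoc] using this
  have hsum := (Real.summable_pow_div_factorial (M * D)).mul_left ‖y‖
  -- Differentiation shifts the index: the derivative of `P (n + 1)` is `L (P n)`, and that of the
  -- constant `P 0` is `0`.
  let u : ℕ → ℝ := fun n => Nat.casesOn n 0 fun n => M * (‖y‖ * ((M * D) ^ n / n.factorial))
  let P' : ℕ → ℂ → E := fun n z => Nat.casesOn n 0 fun n => L z (P n z)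
  have hu : Summable u := (summable_nat_add_iff 1).1 (hsum.mul_left M)
  have hball : Metric.ball z₀ ε ⊆ Metric.closedBall z₀ ε := Metric.ball_subset_closedBall
  have hLM : ∀ z ∈ Metric.closedBall z₀ ε, ‖L z‖ ≤ M := by
    intro z hz
    simpa using hM (1, z) ⟨by simp, hz⟩
  have hPsum : ∀ z ∈ Metric.closedBall z₀ ε, Summable fun n => P n z := fun z hz =>
    Summable.of_norm_bounded hsum (fun n => hbound' n z hz)
  have key := hasDerivAt_tsum_of_isPreconnected (g := P) (g' := P') hu Metric.isOpen_ball
    (convex_ball z₀ ε).isPreconnected (y₀ := z₀) (y := z₀) ?_ ?_ (Metric.mem_ball_self hε)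
    (hPsum z₀ (by simp [hε.le])) (Metric.mem_ball_self hε)
  · convert key using 1
    have h1 : Summable fun n => L z₀ (P n z₀) :=
      (hPsum z₀ (by simp [hε.le])).map (L z₀) (L z₀).continuous
    rw [ContinuousLinearMap.map_tsum _ (hPsum z₀ (by simp [hε.le]))]
    have h2 : Summable fun n => P' n z₀ := (summable_nat_add_iff 1).1 h1
    rw [h2.tsum_eq_zero_add]
    simp [P']
  · intro n z hz
    cases n with
    | zero => exact hasDerivAt_const z y
    | succ n => exact hPd n z (hεU (hball hz))
  · intro n z hz
    cases n with
    | zero => simp [P', u]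
    | succ n =>
      exact (ContinuousLinearMap.le_opNorm _ _).trans
        (mul_le_mul (hLM z (hball hz)) (hbound' n z (hball hz)) (norm_nonneg _) hM0)

variable {A : Type*} [NormedRing A] [NormedAlgebra ℂ A] [CompleteSpace A]

/-- The derivative of the inverse of an invertible solution of `Φ' = a Φ`. -/
theorem HasDerivAt.ringInverse_solution {Φ : ℂ → A} {a : A} {z : ℂ}
    (h : HasDerivAt Φ (a * Φ z) z) (hu : IsUnit (Φ z)) :
    HasDerivAt (fun w => Ring.inverse (Φ w)) (-(Ring.inverse (Φ z) * a)) z := by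
  obtain ⟨x, hx⟩ := hu
  have h1 := hasFDerivAt_ringInverse (𝕜 := ℂ) x
  rw [hx] at h1
  have := h1.comp_hasDerivAt z h
  refine this.congr_deriv ?_
  simp [← hx, mul_assoc]

/-- Two solutions of `Φ' = a Φ`, the first invertible, differ by a constant right factor. -/
theorem exists_eq_mul_of_solutions {U : Set ℂ} (hU : IsOpen U) (hc : IsPreconnected U)
    {a Φ Φ' : ℂ → A} (h : ∀ z ∈ U, HasDerivAt Φ (a z * Φ z) z) (hu : ∀ z ∈ U, IsUnit (Φ z))
    (h' : ∀ z ∈ U, HasDerivAt Φ' (a z * Φ' z) z) :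
    ∃ M : A, ∀ z ∈ U, Φ' z = Φ z * M := by
  have hd : ∀ z ∈ U, HasDerivAt (fun w => Ring.inverse (Φ w) * Φ' w) 0 z := by
    intro z hz
    refine (((h z hz).ringInverse_solution (hu z hz)).mul (h' z hz)).congr_deriv ?_
    simp [mul_assoc]
  obtain ⟨M, hM⟩ := hU.exists_is_const_of_deriv_eq_zero hc
    (fun z hz => (hd z hz).differentiableAt.differentiableWithinAt) (fun z hz => (hd z hz).deriv)
  refine ⟨M, fun z hz => ?_⟩
  rw [← hM z hz, ← mul_assoc, Ring.mul_inverse_cancel _ (hu z hz), one_mul]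

/-- Existence of invertible solutions of `Φ' = a Φ` on convex open sets. -/
theorem exists_isUnit_solution [FiniteDimensional ℂ A] {U : Set ℂ} (hU : IsOpen U)
    (hc : Convex ℝ U) {a : ℂ → A} (ha : DifferentiableOn ℂ a U) {b : ℂ} (hb : b ∈ U) :
    ∃ Φ : ℂ → A, Φ b = 1 ∧ (∀ z ∈ U, HasDerivAt Φ (a z * Φ z) z) ∧ ∀ z ∈ U, IsUnit (Φ z) := by
  obtain ⟨Φ, hΦb, hΦ⟩ := exists_hasDerivAt_linear hU hc
    (L := fun z => ContinuousLinearMap.mul ℂ A (a z))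
    ((ContinuousLinearMap.mul ℂ A).differentiable.comp_differentiableOn ha) hb 1
  -- `Θ` solves the adjoint equation `Θ' = -Θ a`, so `Θ Φ` is constant. This gives a left inverse,
  -- which is two-sided in finite dimension.
  obtain ⟨Θ, hΘb, hΘ⟩ := exists_hasDerivAt_linear hU hc
    (L := fun z => -(ContinuousLinearMap.mul ℂ A).flip (a z))
    ((ContinuousLinearMap.mul ℂ A).flip.differentiable.comp_differentiableOn ha).neg hb 1
  refine ⟨Φ, hΦb, hΦ, ?_⟩
  have hd : ∀ z ∈ U, HasDerivAt (fun w => Θ w * Φ w) 0 z := by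
    intro z hz
    refine ((hΘ z hz).mul (hΦ z hz)).congr_deriv ?_
    simp [mul_assoc]
  have h1 : ∀ z ∈ U, Θ z * Φ z = 1 := by
    intro z hz
    have := hU.is_const_of_deriv_eq_zero hc.isPreconnected
      (fun z hz => (hd z hz).differentiableAt.differentiableWithinAt)
      (fun z hz => (hd z hz).deriv) hz hb
    simpa [hΦb, hΘb] using this
  intro z hz
  have : IsArtinianRing A := IsArtinianRing.of_finite ℂ A
  have : IsDedekindFiniteMonoid A := inferInstance
  exact IsUnit.of_mul_eq_one_right _ (h1 z hz)

end LinearODE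

open scoped Matrix.Norms.Operator

/-- Differentiability of matrix-valued functions is entrywise. -/
theorem Matrix.hasDerivAt_iff_entries {m : ℕ} {Φ : ℂ → Matrix (Fin m) (Fin m) ℂ}
    {X : Matrix (Fin m) (Fin m) ℂ} {z : ℂ} :
    HasDerivAt Φ X z ↔ ∀ i j, HasDerivAt (fun w => Φ w i j) (X i j) z :=
  ⟨fun h i j => hasDerivAt_pi.1 (hasDerivAt_pi.1 h i) j,
    fun h => hasDerivAt_pi.2 fun i => hasDerivAt_pi.2 (h i)⟩

/-- Differentiability of matrix-valued functions is entrywise. -/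
theorem Matrix.differentiableAt_iff_entries {m : ℕ} {Φ : ℂ → Matrix (Fin m) (Fin m) ℂ} {z : ℂ} :
    DifferentiableAt ℂ Φ z ↔ ∀ i j, DifferentiableAt ℂ (fun w => Φ w i j) z :=
  ⟨fun h i j => (Matrix.hasDerivAt_iff_entries.1 h.hasDerivAt i j).differentiableAt,
    fun h => (Matrix.hasDerivAt_iff_entries (X := Matrix.of fun _ _ => _).2
      fun i j => (h i j).hasDerivAt).differentiableAt⟩

/-- Analyticity of matrix-valued functions is entrywise. -/
theorem Matrix.analyticAt_iff_entries {m : ℕ} {Φ : ℂ → Matrix (Fin m) (Fin m) ℂ} {z : ℂ} :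
    AnalyticAt ℂ Φ z ↔ ∀ i j, AnalyticAt ℂ (fun w => Φ w i j) z := by
  simp only [Complex.analyticAt_iff_eventually_differentiableAt]
  refine Iff.trans (eventually_congr (Eventually.of_forall fun w =>
    Matrix.differentiableAt_iff_entries)) ?_
  simp only [eventually_all]

/-! ### Geometry of the plane without the cuts. -/

namespace BranchCuts

variable {n : ℕ} {u : Fin n → ℂ} (c : BranchCuts u)

theorem mem_cut_iff (k : Fin n) (z : ℂ) :
    z ∈ c.cut k ↔ ((z - u k) / c.dir).im = 0 ∧ 0 ≤ ((z - u k) / c.dir).re := by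
  constructor
  · rintro ⟨t, ht, rfl⟩
    simp [c.dir_ne_zero, ht]
  · rintro ⟨h1, h2⟩
    refine ⟨_, h2, ?_⟩
    have : ((((z - u k) / c.dir).re : ℝ) : ℂ) = (z - u k) / c.dir :=
      Complex.ext (by simp) (by simp [h1])
    rw [this, div_mul_cancel₀ _ c.dir_ne_zero]
    ring

theorem mem_domain_iff (z : ℂ) :
    z ∈ c.domain ↔ ∀ k, ((z - u k) / c.dir).im ≠ 0 ∨ ((z - u k) / c.dir).re < 0 := by
  simp only [domain, Set.mem_ofPred_eq, mem_cut_iff, not_and_or, not_le]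

theorem isOpen_domain : IsOpen c.domain := by
  have : c.domain = ⋂ k, ({z | ((z - u k) / c.dir).im ≠ 0} ∪ {z | ((z - u k) / c.dir).re < 0}) := by
    ext z
    simp [mem_domain_iff]
  rw [this]
  refine isOpen_iInter_of_finite fun k => ?_
  have hc : Continuous fun z : ℂ => (z - u k) / c.dir := by fun_prop
  exact (isOpen_ne_fun (Complex.continuous_im.comp hc) continuous_const).union
    (isOpen_lt (Complex.continuous_re.comp hc) continuous_const)

theorem ne_of_mem_domain {z : ℂ} (hz : z ∈ c.domain) (k : Fin n) : z ≠ u k := by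
  rintro rfl
  exact hz k ⟨0, le_rfl, by simp⟩

/-- The half-infinite box below `z`, where `dir` points upwards. -/
def box (z : ℂ) (δ : ℝ) : Set ℂ :=
  {w | (w / c.dir).im - (z / c.dir).im < δ ∧ (z / c.dir).im - (w / c.dir).im < δ ∧
    (w / c.dir).re - (z / c.dir).re < δ}

theorem isOpen_box (z : ℂ) (δ : ℝ) : IsOpen (c.box z δ) := by
  have hc : Continuous fun z : ℂ => z / c.dir := by fun_prop
  have h1 := Complex.continuous_im.comp hc
  have h2 := Complex.continuous_re.comp hc
  exact (isOpen_lt (h1.sub continuous_const) continuous_const).inter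
    ((isOpen_lt (continuous_const.sub h1) continuous_const).inter
      (isOpen_lt (h2.sub continuous_const) continuous_const))

theorem add_smul_div (z w : ℂ) (a b : ℝ) :
    (a • z + b • w) / c.dir = a * (z / c.dir) + b * (w / c.dir) := by
  simp only [Complex.real_smul]
  ring

theorem convex_box (z : ℂ) (δ : ℝ) : Convex ℝ (c.box z δ) := by
  rintro x ⟨hx1, hx2, hx3⟩ y ⟨hy1, hy2, hy3⟩ a b ha hb hab
  obtain rfl : a = 1 - b := by linarith
  simp only [box, Set.mem_ofPred_eq, add_smul_div, Complex.add_re, Complex.add_im,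
    Complex.re_ofReal_mul, Complex.im_ofReal_mul]
  refine ⟨?_, ?_, ?_⟩ <;> rcases hb.eq_or_lt with rfl | hb' <;> first | linarith | nlinarith

theorem mem_box_self (z : ℂ) {δ : ℝ} (hδ : 0 < δ) : z ∈ c.box z δ := by
  simp [box, hδ]

/-- The half-plane `Re (z / dir) < -r`. -/
def lowerHalf (r : ℝ) : Set ℂ := {z | (z / c.dir).re < -r}

theorem isOpen_lowerHalf (r : ℝ) : IsOpen (c.lowerHalf r) :=
  isOpen_lt (Complex.continuous_re.comp (by fun_prop)) continuous_const

theorem convex_lowerHalf (r : ℝ) : Convex ℝ (c.lowerHalf r) := by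
  intro x hx y hy a b ha hb hab
  obtain rfl : a = 1 - b := by linarith
  simp only [lowerHalf, Set.mem_ofPred_eq, add_smul_div, Complex.add_re,
    Complex.re_ofReal_mul] at *
  rcases hb.eq_or_lt with rfl | hb' <;> first | linarith | nlinarith

theorem exists_lowerHalf_subset : ∃ r₀ : ℝ, ∀ r, r₀ ≤ r → c.lowerHalf r ⊆ c.domain := by
  obtain ⟨r₀, hr₀⟩ := (Finset.univ.image fun k => -(u k / c.dir).re).exists_le
  refine ⟨r₀, fun r hr z hz => (c.mem_domain_iff z).2 fun k => Or.inr ?_⟩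
  have := hr₀ _ (Finset.mem_image_of_mem _ (Finset.mem_univ k))
  simp only [lowerHalf, Set.mem_ofPred_eq] at hz
  rw [sub_div, Complex.sub_re]
  linarith

/-- Moving opposite to `dir` never runs into a cut, so the box may be infinite on that side and only
its other sides have to be close to `z`. Such boxes all reach the far half-plane, which makes gluing
possible. -/
theorem exists_box_subset {z : ℂ} (hz : z ∈ c.domain) : ∃ δ, 0 < δ ∧ c.box z δ ⊆ c.domain := by
  have : ∀ᶠ δ : ℝ in 𝓝[>] 0, ∀ k, ∀ w ∈ c.box z δ,
      ((w - u k) / c.dir).im ≠ 0 ∨ ((w - u k) / c.dir).re < 0 := by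
    rw [eventually_all]
    intro k
    simp only [box, Set.mem_ofPred_eq, sub_div, Complex.sub_re, Complex.sub_im]
    have hk := (c.mem_domain_iff z).1 hz k
    simp only [sub_div, Complex.sub_re, Complex.sub_im] at hk
    rcases hk with h | h
    · filter_upwards [Ioo_mem_nhdsGT (abs_pos.2 h)] with δ hδ w hw
      left
      intro h0
      have := hδ.2
      rcases lt_or_gt_of_ne h with h' | h'
      · rw [abs_of_neg h'] at this
        linarith
      · rw [abs_of_pos h'] at this
        linarith
    · filter_upwards [Ioo_mem_nhdsGT (neg_pos.2 h)] with δ hδ w hw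
      right
      linarith [hδ.2]
  obtain ⟨δ, h1, h2⟩ := (this.and self_mem_nhdsWithin).exists
  exact ⟨δ, h2, fun w hw => (c.mem_domain_iff w).2 fun k => h1 k w hw⟩

theorem sub_mul_dir_div (z : ℂ) (t : ℝ) : (z - t * c.dir) / c.dir = z / c.dir - t := by
  rw [sub_div, mul_div_cancel_right₀ _ c.dir_ne_zero]

theorem sub_mem_box {z w : ℂ} {δ t : ℝ} (hw : w ∈ c.box z δ) (ht : 0 ≤ t) :
    w - t * c.dir ∈ c.box z δ := by
  obtain ⟨h1, h2, h3⟩ := hw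
  simp only [box, Set.mem_ofPred_eq, sub_mul_dir_div, Complex.sub_re, Complex.sub_im,
    Complex.ofReal_re, Complex.ofReal_im, sub_zero]
  exact ⟨h1, h2, by linarith⟩

theorem exists_sub_mem_lowerHalf (z : ℂ) (r : ℝ) :
    ∃ t : ℝ, 0 ≤ t ∧ z - t * c.dir ∈ c.lowerHalf r := by
  refine ⟨|(z / c.dir).re + r| + 1, by positivity, ?_⟩
  simp only [lowerHalf, Set.mem_ofPred_eq, sub_mul_dir_div, Complex.sub_re, Complex.ofReal_re]
  linarith [le_abs_self ((z / c.dir).re + r)]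

/-- A shift by `s` perpendicular to `dir` can land on the line of a given cut for one value of `s`
only, so all small positive shifts avoid the finitely many cuts. -/
theorem dense_domain : Dense c.domain := by
  intro z
  rw [mem_closure_iff_frequently]
  have h1 : Tendsto (fun s : ℝ => z + s * Complex.I * c.dir) (𝓝[>] 0) (𝓝 z) := by
    have : Continuous fun s : ℝ => z + s * Complex.I * c.dir := by fun_prop
    exact (this.tendsto' 0 z (by simp)).mono_left nhdsWithin_le_nhds
  refine h1.frequently (Eventually.frequently ?_)
  have : ∀ᶠ s : ℝ in 𝓝[>] 0, ∀ k, ((z - u k) / c.dir).im + s ≠ 0 := by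
    rw [eventually_all]
    intro k
    by_cases h : ((z - u k) / c.dir).im = 0
    · filter_upwards [self_mem_nhdsWithin] with s hs
      simpa [h] using (ne_of_gt hs)
    · refine nhdsWithin_le_nhds ?_
      have : ContinuousAt (fun s : ℝ => ((z - u k) / c.dir).im + s) 0 := by fun_prop
      exact this.eventually_ne (by simpa using h)
  filter_upwards [this] with s hs
  refine (c.mem_domain_iff _).2 fun k => Or.inl ?_
  have : (z + s * Complex.I * c.dir - u k) / c.dir = (z - u k) / c.dir + s * Complex.I := by
    field_simp [c.dir_ne_zero]
    ring
  rw [this]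
  simpa using hs k

theorem domain_nonempty : c.domain.Nonempty := c.dense_domain.nonempty

end BranchCuts

/-! ### Global fundamental matrices. -/

namespace FuchsianSystem

variable {n m : ℕ} {u : Fin n → ℂ} (S : FuchsianSystem m u)

/-- The coefficient matrix `∑ₖ Aₖ/(z - uₖ)`. -/
def coeff (z : ℂ) : Matrix (Fin m) (Fin m) ℂ := ∑ k, (z - u k)⁻¹ • S.A k

theorem differentiableOn_coeff {U : Set ℂ} (hU : ∀ z ∈ U, ∀ k, z ≠ u k) :
    DifferentiableOn ℂ S.coeff U := by
  unfold coeff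
  refine DifferentiableOn.fun_sum fun k _ => ?_
  refine DifferentiableOn.smul_const ?_ _
  exact DifferentiableOn.inv (by fun_prop) fun z hz => sub_ne_zero.2 (hU z hz k)

theorem isFundamental_iff (c : BranchCuts u) (Φ : ℂ → Matrix (Fin m) (Fin m) ℂ) :
    S.IsFundamental c Φ ↔ (∀ z ∈ c.domain, HasDerivAt Φ (S.coeff z * Φ z) z) ∧
      ∀ z ∈ c.domain, IsUnit (Φ z) := by
  simp only [IsFundamental, Matrix.hasDerivAt_iff_entries, Matrix.isUnit_iff_isUnit_det,
    isUnit_iff_ne_zero, coeff]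

variable {S} in
theorem IsFundamental.mul_isUnit {c : BranchCuts u} {Φ : ℂ → Matrix (Fin m) (Fin m) ℂ}
    (h : S.IsFundamental c Φ) {M : Matrix (Fin m) (Fin m) ℂ} (hM : IsUnit M) :
    S.IsFundamental c fun z => Φ z * M := by
  rw [isFundamental_iff] at *
  refine ⟨fun z hz => ?_, fun z hz => (h.2 z hz).mul hM⟩
  rw [← mul_assoc]
  exact (h.1 z hz).mul_const M

/-- Existence of fundamental matrices on the plane without the cuts. -/
theorem exists_isFundamental (c : BranchCuts u) :
    ∃ Φ : ℂ → Matrix (Fin m) (Fin m) ℂ, S.IsFundamental c Φ := by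
  obtain ⟨r, hr⟩ := c.exists_lowerHalf_subset
  have hH := hr r le_rfl
  have hdiff : ∀ {U : Set ℂ}, U ⊆ c.domain → DifferentiableOn ℂ S.coeff U := fun hU =>
    S.differentiableOn_coeff fun z hz => c.ne_of_mem_domain (hU hz)
  obtain ⟨t, -, hb⟩ := c.exists_sub_mem_lowerHalf 0 r
  obtain ⟨Φ, -, hΦ, hΦu⟩ := exists_isUnit_solution (c.isOpen_lowerHalf r) (c.convex_lowerHalf r)
    (hdiff hH) hb
  -- On each box the local solution is normalized by the value of `Φ` at a point `q` of the far
  -- half-plane. The box meets that half-plane in a convex set, so the two solutions agree on all of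
  -- it.
  have hloc : ∀ z ∈ c.domain, ∃ (δ : ℝ) (F : ℂ → Matrix (Fin m) (Fin m) ℂ),
      0 < δ ∧ c.box z δ ⊆ c.domain ∧
      (∀ w ∈ c.box z δ, HasDerivAt F (S.coeff w * F w) w) ∧ (∀ w ∈ c.box z δ, IsUnit (F w)) ∧
      ∀ w ∈ c.box z δ ∩ c.lowerHalf r, F w = Φ w := by
    intro z hz
    obtain ⟨δ, hδ, hbox⟩ := c.exists_box_subset hz
    obtain ⟨t, ht, hq⟩ := c.exists_sub_mem_lowerHalf z r
    set q := z - t * c.dir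
    have hq' : q ∈ c.box z δ := c.sub_mem_box (c.mem_box_self z hδ) ht
    obtain ⟨X, hXq, hX, hXu⟩ := exists_isUnit_solution (c.isOpen_box z δ) (c.convex_box z δ)
      (hdiff hbox) hq'
    refine ⟨δ, fun w => X w * Φ q, hδ, hbox, fun w hw => ?_, fun w hw => (hXu w hw).mul (hΦu q hq),
      fun w hw => ?_⟩
    · rw [← mul_assoc]
      exact (hX w hw).mul_const _
    · obtain ⟨M, hM⟩ := exists_eq_mul_of_solutions
        ((c.isOpen_box z δ).inter (c.isOpen_lowerHalf r))
        ((c.convex_box z δ).inter (c.convex_lowerHalf r)).isPreconnected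
        (fun z hz => hX z hz.1) (fun z hz => hXu z hz.1) (fun z hz => hΦ z hz.2)
      have hMq := hM q ⟨hq', hq⟩
      rw [hXq, one_mul] at hMq
      rw [hM w hw, hMq]
  choose! δ F hδ hbox hF hFu hFΦ using hloc
  -- Two boxes meet in a convex set stable under translation by `-t * dir`. It reaches the
  -- half-plane, where both solutions equal `Φ`, so they agree throughout. No simple connectedness
  -- is needed.
  have hagree : ∀ z ∈ c.domain, ∀ w ∈ c.box z (δ z), F w w = F z w := by
    intro z hz w hw
    have hw' := hbox z hz hw
    obtain ⟨t, ht, hq⟩ := c.exists_sub_mem_lowerHalf w r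
    have hq1 := c.sub_mem_box hw ht
    have hq2 := c.sub_mem_box (c.mem_box_self w (hδ w hw')) ht
    set q := w - t * c.dir
    obtain ⟨M, hM⟩ := exists_eq_mul_of_solutions
      ((c.isOpen_box z (δ z)).inter (c.isOpen_box w (δ w)))
      ((c.convex_box z (δ z)).inter (c.convex_box w (δ w))).isPreconnected
      (fun x hx => hF z hz x hx.1) (fun x hx => hFu z hz x hx.1) (fun x hx => hF w hw' x hx.2)
    have h1 := hM q ⟨hq1, hq2⟩
    rw [hFΦ z hz q ⟨hq1, hq⟩, hFΦ w hw' q ⟨hq2, hq⟩] at h1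
    have hM1 : M = 1 := by
      have := (hΦu q hq).mul_left_cancel (h1.symm.trans (mul_one _).symm)
      exact this
    rw [hM w ⟨hw, c.mem_box_self w (hδ w hw')⟩, hM1, mul_one]
  refine ⟨fun z => F z z, (S.isFundamental_iff c _).2 ⟨fun z hz => ?_, fun z hz =>
    hFu z hz z (c.mem_box_self z (hδ z hz))⟩⟩
  refine (hF z hz z (c.mem_box_self z (hδ z hz))).congr_of_eventuallyEq ?_
  filter_upwards [(c.isOpen_box z (δ z)).mem_nhds (c.mem_box_self z (hδ z hz))] with w hw
  exact hagree z hz w hw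

end FuchsianSystem

/-! ### Formal normal form at a Fuchsian singularity, with growth bounds. -/

/-- Sequences can be defined by course-of-values recursion. -/
theorem exists_seq_eq_of_lt {α : Type*} [Inhabited α] (F : ℕ → (ℕ → α) → α)
    (hF : ∀ n s s', (∀ k < n, s k = s' k) → F n s = F n s') : ∃ s : ℕ → α, ∀ n, s n = F n s := by
  refine ⟨Nat.strongRec fun n ih => F n fun k => if h : k < n then ih k h else default,
    fun n => ?_⟩
  beta_reduce
  rw [Nat.strongRec_eq]
  exact hF n _ _ fun k hk => by simp [hk]

/-- A discrete Gronwall inequality: geometrically weighted recursive bounds give geometric growth. -/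
theorem le_geometric_of_le_sum {a : ℕ → ℝ} {M ρ : ℝ} (hM : 0 ≤ M) (hρ : 0 ≤ ρ)
    (h : ∀ n, 0 < n → a n ≤ M * ∑ b ∈ Finset.range n, ρ ^ (n - b) * a b) (n : ℕ) :
    a n ≤ |a 0| * (ρ * (1 + M)) ^ n := by
  -- The ratio `ρ (1 + M)` is the one for which the recursion bound evaluates to the next power
  -- minus `ρ ^ n`, so the geometric sequence dominates.
  have hsum : ∀ n, M * ∑ b ∈ Finset.range n, ρ ^ (n - b) * (ρ * (1 + M)) ^ b =
      (ρ * (1 + M)) ^ n - ρ ^ n := by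
    intro n
    induction n with
    | zero => simp
    | succ n ih =>
      rw [Finset.sum_range_succ, Finset.sum_congr rfl (g := fun b =>
        ρ * (ρ ^ (n - b) * (ρ * (1 + M)) ^ b)), ← Finset.mul_sum, mul_add, mul_left_comm, ih]
      · simp only [add_tsub_cancel_left, pow_one]
        ring
      · intro b hb
        rw [Nat.succ_sub (Finset.mem_range.1 hb).le, pow_succ']
        ring
  induction n using Nat.strong_induction_on with
  | _ n ih =>
    rcases Nat.eq_zero_or_pos n with rfl | hn
    · simpa using le_abs_self _
    calc a n ≤ M * ∑ b ∈ Finset.range n, ρ ^ (n - b) * a b := h n hn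
      _ ≤ M * ∑ b ∈ Finset.range n, ρ ^ (n - b) * (|a 0| * (ρ * (1 + M)) ^ b) := by
          gcongr with b hb
          exact ih b (Finset.mem_range.1 hb)
      _ = |a 0| * (M * ∑ b ∈ Finset.range n, ρ ^ (n - b) * (ρ * (1 + M)) ^ b) := by
          simp only [Finset.mul_sum]
          exact Finset.sum_congr rfl fun b _ => by ring
      _ ≤ |a 0| * (ρ * (1 + M)) ^ n := by
          rw [hsum]
          have : 0 ≤ ρ ^ n := by positivity
          gcongr
          linarith

section Resonance

variable {m : ℕ} (l : Fin m → ℂ)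

/-- The part of a matrix that shifts the eigenvalues of `diag(l₁, …, lₘ)` by exactly `n`. -/
def resonantPart (n : ℕ) (T : Matrix (Fin m) (Fin m) ℂ) : Matrix (Fin m) (Fin m) ℂ :=
  Matrix.of fun i j => if l i = l j + n then T i j else 0

/-- The solution `X` of `n X + [X, diag(l₁, …, lₘ)] = T` modulo the resonant part. -/
def nonresonantQuotient (n : ℕ) (T : Matrix (Fin m) (Fin m) ℂ) : Matrix (Fin m) (Fin m) ℂ :=
  Matrix.of fun i j => if l i = l j + n then 0 else T i j / (n + l j - l i)

/-- Entrywise the equation reads `(n + lⱼ - lᵢ) Xᵢⱼ = Tᵢⱼ`; it is solvable unless the divisor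
vanishes, and those entries are moved to the resonant part. -/
theorem nonresonantQuotient_equation (n : ℕ) (T : Matrix (Fin m) (Fin m) ℂ) :
    (n : ℂ) • nonresonantQuotient l n T + nonresonantQuotient l n T * diagonal l + resonantPart l n T
      = diagonal l * nonresonantQuotient l n T + T := by
  ext i j
  simp only [nonresonantQuotient, resonantPart, Matrix.add_apply, Matrix.smul_apply,
    Matrix.mul_diagonal, Matrix.diagonal_mul, Matrix.of_apply, smul_eq_mul]
  split_ifs with h
  · simp
  · have : (n : ℂ) + l j - l i ≠ 0 := fun h' => h (by linear_combination -h')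
    field_simp
    ring

theorem Matrix.norm_le_of_entries_le {X Y : Matrix (Fin m) (Fin m) ℂ} {K : ℝ} (hK : 0 ≤ K)
    (h : ∀ i j, ‖X i j‖ ≤ K * ‖Y i j‖) : ‖X‖ ≤ K * ‖Y‖ := by
  lift K to NNReal using hK
  have h' : ∀ i j, ‖X i j‖₊ ≤ K * ‖Y i j‖₊ := fun i j => h i j
  suffices ‖X‖₊ ≤ K * ‖Y‖₊ from this
  rw [Matrix.linfty_opNNNorm_def, Matrix.linfty_opNNNorm_def]
  refine Finset.sup_le fun i _ => ?_
  calc ∑ j, ‖X i j‖₊ ≤ ∑ j, K * ‖Y i j‖₊ := Finset.sum_le_sum fun j _ => h' i j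
    _ = K * ∑ j, ‖Y i j‖₊ := by rw [Finset.mul_sum]
    _ ≤ _ := by
      gcongr
      exact Finset.le_sup (f := fun i => ∑ j, ‖Y i j‖₊) (Finset.mem_univ i)

/-- There are no small divisors: `n + lⱼ - lᵢ` tends to infinity with `n`, so the inverses are
bounded uniformly in `n`. This is what makes the formal series converge. -/
theorem exists_norm_nonresonantQuotient_le :
    ∃ K : ℝ, 0 ≤ K ∧ ∀ n T, ‖nonresonantQuotient l n T‖ ≤ K * ‖T‖ := by
  have h1 : ∀ p : Fin m × Fin m, ∃ K : ℝ, ∀ n : ℕ, ‖((n : ℂ) + l p.2 - l p.1)⁻¹‖ ≤ K := by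
    intro p
    have : Tendsto (fun n : ℕ => ((n : ℂ) + l p.2 - l p.1)⁻¹) atTop (𝓝 0) := by
      have h := tendsto_inv₀_cobounded.comp ((tendsto_add_const_cobounded (l p.2 - l p.1)).comp
        (tendsto_natCast_atTop_cobounded (α := ℂ)))
      simpa [Function.comp_def, add_sub_assoc] using h
    obtain ⟨K, hK⟩ := this.norm.bddAbove_range
    exact ⟨K, fun n => hK ⟨n, rfl⟩⟩
  choose K hK using h1
  have hK0 : ∀ p, 0 ≤ K p := fun p => (norm_nonneg _).trans (hK p 0)
  refine ⟨∑ p, K p, Finset.sum_nonneg fun p _ => hK0 p, fun n T => ?_⟩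
  refine Matrix.norm_le_of_entries_le (Finset.sum_nonneg fun p _ => hK0 p) fun i j => ?_
  have hij : K (i, j) ≤ ∑ p, K p := Finset.single_le_sum (fun p _ => hK0 p) (Finset.mem_univ (i, j))
  simp only [nonresonantQuotient, Matrix.of_apply]
  split_ifs
  · simpa using mul_nonneg (Finset.sum_nonneg fun p _ => hK0 p) (norm_nonneg (T i j))
  · rw [div_eq_inv_mul, norm_mul]
    gcongr
    exact (hK (i, j) n).trans hij

theorem resonantPart_apply_ne_zero {n : ℕ} {T : Matrix (Fin m) (Fin m) ℂ} {i j : Fin m}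
    (h : resonantPart l n T i j ≠ 0) : l i = l j + n := by
  by_contra h'
  simp [resonantPart, h'] at h

/-- A resonance at `n` forces `n = ‖lᵢ - lⱼ‖`, and there are finitely many pairs. Hence the total
`R` is a finite sum. -/
theorem exists_resonantPart_eq_zero : ∃ N : ℕ, ∀ n, N ≤ n → ∀ T, resonantPart l n T = 0 := by
  obtain ⟨N, hN⟩ := (Finset.univ.image fun p : Fin m × Fin m =>
    ⌈‖l p.1 - l p.2‖⌉₊ + 1).exists_le
  refine ⟨N, fun n hn T => ?_⟩
  ext i j
  by_contra h
  have h1 := resonantPart_apply_ne_zero l h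
  have h2 := hN _ (Finset.mem_image_of_mem _ (Finset.mem_univ (i, j)))
  have h3 : ‖l i - l j‖ = n := by simp [h1]
  simp only [h3, Nat.ceil_natCast] at h2
  omega

/-- The formal Levelt normal form at a Fuchsian singularity, with geometric bounds. -/
theorem exists_formal_normal_form {B : ℕ → Matrix (Fin m) (Fin m) ℂ} (hB0 : B 0 = diagonal l)
    {C ρ : ℝ} (hρ : 0 < ρ) (hB : ∀ n, ‖B n‖ ≤ C * ρ ^ n) :
    ∃ (Ψ R : ℕ → Matrix (Fin m) (Fin m) ℂ) (N : ℕ), Ψ 0 = 1 ∧ R 0 = 0 ∧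
      (∀ n, N ≤ n → R n = 0) ∧ (∀ n i j, R n i j ≠ 0 → l i = l j + n) ∧
      (∃ D σ : ℝ, 0 < σ ∧ ∀ n, ‖Ψ n‖ ≤ D * σ ^ n) ∧
      ∀ n : ℕ, (n : ℂ) • Ψ n + Ψ n * diagonal l + ∑ b ∈ Finset.range (n + 1), Ψ b * R (n - b) =
        ∑ b ∈ Finset.range (n + 1), B b * Ψ (n - b) := by
  let P : (ℕ → Matrix (Fin m) (Fin m) ℂ) → ℕ → Matrix (Fin m) (Fin m) ℂ :=
    fun s n => if n = 0 then 1 else nonresonantQuotient l n (s n)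
  let Q : (ℕ → Matrix (Fin m) (Fin m) ℂ) → ℕ → Matrix (Fin m) (Fin m) ℂ :=
    fun s n => if n = 0 then 0 else resonantPart l n (s n)
  -- `s n` collects the known terms at order `n`; its nonresonant part determines `Ψ n` and its
  -- resonant part is `R n`. The term `b = 0` of `∑ Ψ b * R (n - b)` is left out because it is the
  -- unknown `R n` itself.
  obtain ⟨s, hs⟩ := exists_seq_eq_of_lt (fun n s => ∑ b ∈ Finset.range n,
    (B (n - b) * P s b - if b = 0 then 0 else P s b * Q s (n - b))) (by
      intro n s s' h
      refine Finset.sum_congr rfl fun b hb => ?_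
      have hb := Finset.mem_range.1 hb
      have h1 : P s b = P s' b := by simp only [P, h b hb]
      rw [h1]
      split_ifs with h0
      · rfl
      · have h2 : Q s (n - b) = Q s' (n - b) := by
          simp only [Q, h (n - b) (by omega)]
        rw [h2])
  set Ψ := P s with hΨ
  set R := Q s with hR
  have hΨ0 : Ψ 0 = 1 := by simp [hΨ, P]
  have hR0 : R 0 = 0 := by simp [hR, Q]
  obtain ⟨N, hN⟩ := exists_resonantPart_eq_zero l
  have hRN : ∀ n, N ≤ n → R n = 0 := by
    intro n hn
    simp only [hR, Q, hN n hn, ite_self]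
  obtain ⟨K, hK0, hK⟩ := exists_norm_nonresonantQuotient_le l
  refine ⟨Ψ, R, N, hΨ0, hR0, hRN, ?_, ?_, ?_⟩
  · intro n i j h
    by_cases hn : n = 0
    · simp [hR, Q, hn] at h
    · simp only [hR, Q, hn, if_false] at h
      exact resonantPart_apply_ne_zero l h
  · have hC : 0 ≤ C := by simpa using (norm_nonneg _).trans (hB 0)
    -- Only finitely many `R n` are nonzero, so they obey a geometric bound with the same `ρ` as
    -- `B`.
    have hC' : ∀ n, ‖R n‖ ≤ (∑ k ∈ Finset.range N, ‖R k‖ / ρ ^ k) * ρ ^ n := by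
      intro n
      by_cases hn : n < N
      · rw [← div_le_iff₀ (by positivity)]
        exact Finset.single_le_sum (f := fun k => ‖R k‖ / ρ ^ k) (fun k _ => by positivity)
          (Finset.mem_range.2 hn)
      · rw [hRN n (not_lt.1 hn), norm_zero]
        have : 0 ≤ ∑ k ∈ Finset.range N, ‖R k‖ / ρ ^ k :=
          Finset.sum_nonneg fun k _ => by positivity
        positivity
    set C' := ∑ k ∈ Finset.range N, ‖R k‖ / ρ ^ k
    have hC'0 : 0 ≤ C' := Finset.sum_nonneg fun k _ => by positivity
    refine ⟨|‖Ψ 0‖|, ρ * (1 + K * (C + C')), by positivity,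
      le_geometric_of_le_sum (a := fun n => ‖Ψ n‖) (by positivity) hρ.le ?_⟩
    intro n hn
    have h1 : Ψ n = nonresonantQuotient l n (s n) := by simp [hΨ, P, hn.ne']
    rw [h1]
    refine (hK n (s n)).trans ?_
    rw [mul_assoc]
    refine mul_le_mul_of_nonneg_left ?_ hK0
    rw [hs n, Finset.mul_sum]
    refine (norm_sum_le _ _).trans (Finset.sum_le_sum fun b hb => ?_)
    have h2 : ‖B (n - b) * Ψ b‖ ≤ C * ρ ^ (n - b) * ‖Ψ b‖ :=
      (norm_mul_le _ _).trans (by gcongr; exact hB _)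
    have h3 : ‖if b = 0 then 0 else Ψ b * R (n - b)‖ ≤ C' * ρ ^ (n - b) * ‖Ψ b‖ := by
      split_ifs
      · rw [norm_zero]
        positivity
      · rw [mul_comm]
        exact (norm_mul_le _ _).trans (by gcongr; exact hC' _)
    calc _ ≤ ‖B (n - b) * Ψ b‖ + ‖if b = 0 then 0 else Ψ b * R (n - b)‖ := norm_sub_le _ _
      _ ≤ C * ρ ^ (n - b) * ‖Ψ b‖ + C' * ρ ^ (n - b) * ‖Ψ b‖ := add_le_add h2 h3
      _ = _ := by ring
  · intro n
    rcases Nat.eq_zero_or_pos n with rfl | hn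
    · simp [hΨ0, hR0, hB0]
    have h1 : Ψ n = nonresonantQuotient l n (s n) := by simp [hΨ, P, hn.ne']
    have h2 : R n = resonantPart l n (s n) := by simp [hR, Q, hn.ne']
    have h3 := nonresonantQuotient_equation l n (s n)
    rw [← h1, ← h2] at h3
    have h4 : ∑ b ∈ Finset.range n, Ψ b * R (n - b) =
        R n + ∑ b ∈ Finset.range n, if b = 0 then 0 else Ψ b * R (n - b) := by
      obtain ⟨k, rfl⟩ := Nat.exists_eq_succ_of_ne_zero hn.ne'
      rw [Finset.sum_range_succ', Finset.sum_range_succ' (fun b => if b = 0 then _ else _)]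
      simp [hΨ0, add_comm]
    have h5 : ∑ b ∈ Finset.range (n + 1), B b * Ψ (n - b) =
        B 0 * Ψ n + ∑ b ∈ Finset.range n, B (n - b) * Ψ b := by
      rw [← Finset.sum_range_reflect, Finset.sum_range_succ, add_comm]
      congr 1
      · simp
      · refine Finset.sum_congr rfl fun b hb => ?_
        have := Finset.mem_range.1 hb
        congr 2
        omega
    have h6 := hs n
    rw [Finset.sum_sub_distrib] at h6
    rw [Finset.sum_range_succ, Nat.sub_self, hR0, mul_zero, add_zero, h4, h5, hB0,
      ← add_assoc, h3, h6]
    abel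

end Resonance

/-! ### Power series with geometrically bounded coefficients. -/

section PowerSeries

variable {E : Type*} [NormedAddCommGroup E] [NormedSpace ℂ E]

theorem summable_norm_pow_smul {X : ℕ → E} {D σ : ℝ}
    (hX : ∀ n, ‖X n‖ ≤ D * σ ^ n) (hσ : 0 < σ) {w : ℂ} (hw : ‖w‖ * σ < 1) :
    Summable fun n => ‖w ^ n • X n‖ := by
  refine Summable.of_nonneg_of_le (fun n => norm_nonneg _) (fun n => ?_)
    ((summable_geometric_of_lt_one (by positivity) hw).mul_left D)
  rw [norm_smul, norm_pow, mul_pow]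
  calc ‖w‖ ^ n * ‖X n‖ ≤ ‖w‖ ^ n * (D * σ ^ n) := by gcongr; exact hX n
    _ = _ := by ring

theorem norm_natCast_mul_pow_smul_le {X : ℕ → E} {D σ s : ℝ} (hX : ∀ n, ‖X n‖ ≤ D * σ ^ n)
    (hs : 0 < s) (hσ : 0 < σ) {z : ℂ} (hz : ‖z‖ ≤ s) (n : ℕ) :
    ‖((n : ℂ) * z ^ (n - 1)) • X n‖ ≤ D / s * ((n : ℝ) ^ 1 * (s * σ) ^ n) := by
  cases n with
  | zero => simp
  | succ k =>
    rw [norm_smul, norm_mul, norm_pow, Complex.norm_natCast, Nat.add_sub_cancel]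
    calc ((k + 1 : ℕ) : ℝ) * ‖z‖ ^ k * ‖X (k + 1)‖
        ≤ (k + 1 : ℕ) * s ^ k * (D * σ ^ (k + 1)) := by
          gcongr
          exact hX _
      _ = _ := by
        rw [mul_pow, pow_succ s, pow_one]
        field_simp

/-- Termwise differentiation of power series with geometrically bounded coefficients. -/
theorem exists_hasDerivAt_tsum_pow_smul [CompleteSpace E] {X : ℕ → E} {D σ : ℝ}
    (hX : ∀ n, ‖X n‖ ≤ D * σ ^ n) (hσ : 0 < σ) {w : ℂ} (hw : ‖w‖ * σ < 1) :
    ∃ d, HasDerivAt (fun z : ℂ => ∑' n, z ^ n • X n) d w ∧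
      HasSum (fun n : ℕ => w ^ n • ((n : ℂ) • X n)) (w • d) := by
  obtain ⟨s, hs1, hs2⟩ := exists_between ((lt_div_iff₀ hσ).2 hw)
  have hs0 : 0 < s := (norm_nonneg w).trans_lt hs1
  have hsσ : s * σ < 1 := (lt_div_iff₀ hσ).1 hs2
  have hsσ' : ‖s * σ‖ < 1 := by rwa [Real.norm_of_nonneg (by positivity)]
  have hsum : Summable fun n : ℕ => D / s * ((n : ℝ) ^ 1 * (s * σ) ^ n) :=
    (summable_pow_mul_geometric_of_norm_lt_one 1 hsσ').mul_left _
  have hbd : ∀ n : ℕ, ∀ z ∈ Metric.ball (0 : ℂ) s,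
      ‖((n : ℂ) * z ^ (n - 1)) • X n‖ ≤ D / s * ((n : ℝ) ^ 1 * (s * σ) ^ n) := fun n z hz =>
    norm_natCast_mul_pow_smul_le hX hs0 hσ (by simpa using (Metric.mem_ball.1 hz).le) n
  have hw0 : w ∈ Metric.ball (0 : ℂ) s := by simpa using hs1
  have hder := hasDerivAt_tsum_of_isPreconnected (g := fun n (z : ℂ) => z ^ n • X n)
    (g' := fun n (z : ℂ) => ((n : ℂ) * z ^ (n - 1)) • X n) hsum Metric.isOpen_ball
    (convex_ball (0 : ℂ) s).isPreconnected
    (fun n z _ => (hasDerivAt_pow n z).smul_const (X n)) hbd hw0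
    (summable_norm_pow_smul hX hσ hw).of_norm hw0
  refine ⟨_, hder, ?_⟩
  have h1 : Summable fun n : ℕ => ((n : ℂ) * w ^ (n - 1)) • X n :=
    Summable.of_norm_bounded hsum fun n => hbd n w hw0
  have h2 := h1.hasSum.const_smul w
  refine h2.congr_fun ?_
  intro n
  rcases Nat.eq_zero_or_pos n with rfl | hn
  · simp
  obtain ⟨k, rfl⟩ := Nat.exists_eq_add_one.2 hn
  simp only [smul_smul, Nat.add_sub_cancel]
  congr 1
  rw [pow_succ]
  ring

end PowerSeries

/-! ### Convergent Levelt solutions at a Fuchsian singularity. -/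

section LocalNormalForm

variable {m : ℕ} {l : Fin m → ℂ}

/-- A matrix that strictly raises the eigenvalues of `diag(l₁, …, lₘ)` by positive integers is
nilpotent. -/
theorem isNilpotent_of_raises {R : Matrix (Fin m) (Fin m) ℂ}
    (h : ∀ i j, R i j ≠ 0 → ∃ k : ℕ, l i = l j + (k + 1 : ℕ)) : IsNilpotent R := by
  -- Along a nonzero entry of `R ^ n` the real part of the eigenvalue climbs by at least `n`, while
  -- the differences of real parts are bounded.
  have hpow : ∀ (n : ℕ) i j, (R ^ n) i j ≠ 0 → (l j).re + n ≤ (l i).re := by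
    intro n
    induction n with
    | zero =>
      intro i j hij
      have : i = j := by
        by_contra h'
        simp [h'] at hij
      simp [this]
    | succ n ih =>
      intro i j hij
      rw [pow_succ, Matrix.mul_apply] at hij
      obtain ⟨p, -, hp⟩ := Finset.exists_ne_zero_of_sum_ne_zero hij
      have h1 := ih i p (left_ne_zero_of_mul hp)
      obtain ⟨k, hk⟩ := h p j (right_ne_zero_of_mul hp)
      have h2 : (l p).re = (l j).re + (k + 1 : ℕ) := by simp [hk]
      push_cast at h2 ⊢
      have : (0 : ℝ) ≤ k := by positivity
      linarith
  obtain ⟨M, hM⟩ := (Finset.univ.image fun p : Fin m × Fin m => (l p.1).re - (l p.2).re).exists_le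
  obtain ⟨n, hn⟩ := exists_nat_gt M
  refine ⟨n, ?_⟩
  ext i j
  by_contra hij
  have h1 := hpow n i j hij
  have h2 := hM _ (Finset.mem_image_of_mem _ (Finset.mem_univ (i, j)))
  simp only at h2
  linarith

/-- A matrix raising the eigenvalues of `diag(l₁, …, lₘ)` by integers commutes with
`exp (2πi diag(l₁, …, lₘ))`. -/
theorem RaisesSpectrum.commute_exp {R : Matrix (Fin m) (Fin m) ℂ} (h : RaisesSpectrum l R) :
    Commute (diagonal fun i => Complex.exp (2 * Real.pi * Complex.I * l i)) R := by
  ext i j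
  rw [Matrix.diagonal_mul, Matrix.mul_diagonal]
  by_cases hij : R i j = 0
  · simp [hij]
  obtain ⟨k, hk⟩ := h i j hij
  rw [hk, mul_add, Complex.exp_add, mul_comm _ (k : ℂ), Complex.exp_nat_mul_two_pi_mul_I]
  ring

theorem Matrix.exp_smul_diagonal (ζ : ℂ) :
    NormedSpace.exp (ζ • diagonal l) = diagonal fun i => Complex.exp (ζ * l i) := by
  rw [← Matrix.diagonal_smul, Matrix.exp_diagonal, Complex.exp_eq_exp_ℂ]
  congr 1
  ext i
  rw [Pi.coe_exp]
  rfl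

/-- Local Levelt normal form: existence of a convergent solution at a Fuchsian singularity whose
residue matrix is `diag(l₁, …, lₘ)`. -/
theorem exists_local_levelt {B : ℂ → Matrix (Fin m) (Fin m) ℂ} (hB : AnalyticAt ℂ B 0)
    (hB0 : B 0 = diagonal l) :
    ∃ (Ψ : ℂ → Matrix (Fin m) (Fin m) ℂ) (R : Matrix (Fin m) (Fin m) ℂ),
      AnalyticAt ℂ Ψ 0 ∧ Ψ 0 = 1 ∧ IsAdmissiblePair l R ∧
      ∃ ε > 0, ∀ w : ℂ, w ≠ 0 → ‖w‖ < ε → IsUnit (Ψ w) ∧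
        ∀ ℓ : ℂ → ℂ, HasDerivAt ℓ w⁻¹ w → Complex.exp (ℓ w) = w →
          HasDerivAt (fun z => Ψ z * NormedSpace.exp (ℓ z • diagonal l) * NormedSpace.exp (ℓ z • R))
            ((w⁻¹ • B w) *
              (Ψ w * NormedSpace.exp (ℓ w • diagonal l) * NormedSpace.exp (ℓ w • R))) w := by
  obtain ⟨p, hp⟩ := hB
  obtain ⟨C, ρ, -, hρ, hC⟩ := p.le_mul_pow_of_radius_pos hp.radius_pos
  have hsumB := hasFPowerSeriesAt_iff.1 hp
  simp only [zero_add] at hsumB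
  have hp0 : p.coeff 0 = diagonal l := by
    have := hsumB.self_of_nhds
    rw [← hB0, ← this.tsum_eq, tsum_eq_single 0 (fun n hn => by simp [hn]), pow_zero, one_smul]
  have hC' : ∀ n, ‖p.coeff n‖ ≤ C * ρ ^ n := fun n => by
    rw [← FormalMultilinearSeries.norm_apply_eq_norm_coef]
    exact hC n
  obtain ⟨X, Q, N, hX0, hQ0, hQN, hQr, ⟨D, σ, hσ, hD⟩, heq⟩ :=
    exists_formal_normal_form l hp0 hρ hC'
  set Ψ : ℂ → Matrix (Fin m) (Fin m) ℂ := fun z => ∑' n, z ^ n • X n with hΨ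
  set R : Matrix (Fin m) (Fin m) ℂ := ∑ n ∈ Finset.range N, Q n with hR
  have hder : ∀ w : ℂ, ‖w‖ * σ < 1 → ∃ d, HasDerivAt Ψ d w ∧
      HasSum (fun n : ℕ => w ^ n • ((n : ℂ) • X n)) (w • d) :=
    fun w hw => exists_hasDerivAt_tsum_pow_smul hD hσ hw
  have hev : ∀ τ : ℝ, ∀ᶠ w : ℂ in 𝓝 0, ‖w‖ * τ < 1 := by
    intro τ
    have : ContinuousAt (fun w : ℂ => ‖w‖ * τ) 0 := by fun_prop
    exact this.eventually_lt_const (by simp)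
  have hΨan : AnalyticAt ℂ Ψ 0 := by
    rw [Complex.analyticAt_iff_eventually_differentiableAt]
    filter_upwards [hev σ] with w hw
    obtain ⟨d, hd, -⟩ := hder w hw
    exact hd.differentiableAt
  have hΨ0 : Ψ 0 = 1 := by
    simp only [hΨ]
    rw [tsum_eq_single 0 (fun n hn => by simp [hn])]
    simp [hX0]
  have hraise : ∀ i j, R i j ≠ 0 → ∃ k : ℕ, l i = l j + (k + 1 : ℕ) := by
    intro i j hij
    rw [hR, Matrix.sum_apply] at hij
    obtain ⟨n, -, hn⟩ := Finset.exists_ne_zero_of_sum_ne_zero hij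
    have hn0 : n ≠ 0 := by
      rintro rfl
      simp [hQ0] at hn
    obtain ⟨k, rfl⟩ := Nat.exists_eq_succ_of_ne_zero hn0
    exact ⟨k, hQr _ i j hn⟩
  have hraise' : RaisesSpectrum l R := fun i j hij =>
    let ⟨k, hk⟩ := hraise i j hij
    ⟨k + 1, hk⟩
  have hunit : ∀ᶠ w in 𝓝 0, IsUnit (Ψ w) := by
    refine hΨan.continuousAt.eventually_mem (Units.isOpen.mem_nhds ?_)
    rw [hΨ0]
    exact isUnit_one
  obtain ⟨ε, hε, hball⟩ := Metric.eventually_nhds_iff.1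
    (((hev σ).and (hev ρ)).and (hunit.and hsumB))
  refine ⟨Ψ, R, hΨan, hΨ0, ⟨isNilpotent_of_raises hraise, hraise'.commute_exp, hraise'⟩, ε, hε,
    fun w hw0 hwε => ?_⟩
  obtain ⟨⟨hwσ, hwρ⟩, hwu, hwB⟩ := hball (y := w) (by simpa using hwε)
  refine ⟨hwu, fun ℓ hℓ hexp => ?_⟩
  obtain ⟨d, hd, hdsum⟩ := hder w hwσ
  have hX : Summable fun n => ‖w ^ n • X n‖ := summable_norm_pow_smul hD hσ hwσ
  have hP : Summable fun n => ‖w ^ n • p.coeff n‖ := summable_norm_pow_smul hC' hρ hwρ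
  have hQ : Summable fun n => ‖w ^ n • Q n‖ := by
    refine summable_of_ne_finset_zero (s := Finset.range N) fun n hn => ?_
    simp [hQN n (by simpa using hn)]
  -- The formal recursion, summed by Cauchy products: `w Ψ' + Ψ Λ + Ψ ∑ wⁿRₙ = B Ψ`.
  have hode : w • d + Ψ w * diagonal l + Ψ w * ∑' n, w ^ n • Q n = B w * Ψ w := by
    have h1 := (hdsum.add (hX.of_norm.hasSum.mul_right (diagonal l))).add
      (hasSum_sum_range_mul_of_summable_norm hX hQ)
    have h2 := hasSum_sum_range_mul_of_summable_norm hP hX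
    rw [hwB.tsum_eq] at h2
    refine h1.unique (h2.congr_fun fun n => ?_)
    have hpow : ∀ Y Z : ℕ → Matrix (Fin m) (Fin m) ℂ,
        ∑ k ∈ Finset.range (n + 1), w ^ k • Y k * w ^ (n - k) • Z (n - k) =
          w ^ n • ∑ k ∈ Finset.range (n + 1), Y k * Z (n - k) := by
      intro Y Z
      rw [Finset.smul_sum]
      refine Finset.sum_congr rfl fun k hk => ?_
      rw [smul_mul_smul_comm, ← pow_add, Nat.add_sub_cancel' (by simpa [Nat.lt_succ_iff] using hk)]
    rw [hpow, hpow, ← heq n, smul_mul_assoc, smul_add, smul_add]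
  set E₁ := NormedSpace.exp (ℓ w • diagonal l) with hE₁
  set E₂ := NormedSpace.exp (ℓ w • R) with hE₂
  -- Since `Q n` shifts eigenvalues by exactly `n`, conjugation by `w^Λ` multiplies it by `wⁿ`. Thus
  -- the polynomial in `hode` is the conjugate of the constant matrix `R`.
  have hconj : E₁ * R = (∑' n, w ^ n • Q n) * E₁ := by
    rw [tsum_eq_sum (s := Finset.range N) (fun n hn => by simp [hQN n (by simpa using hn)]), hR,
      Finset.mul_sum, Finset.sum_mul]
    refine Finset.sum_congr rfl fun n _ => ?_
    ext i j
    rw [hE₁, Matrix.exp_smul_diagonal, Matrix.diagonal_mul, Matrix.mul_diagonal, Matrix.smul_apply]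
    by_cases hij : Q n i j = 0
    · simp [hij]
    rw [hQr n i j hij, mul_add, Complex.exp_add, mul_comm _ (n : ℂ), Complex.exp_nat_mul, hexp,
      smul_eq_mul]
    ring
  have hd1 : HasDerivAt (fun z => NormedSpace.exp (ℓ z • diagonal l))
      (w⁻¹ • (diagonal l * E₁)) w :=
    (hasDerivAt_exp_smul_const' (diagonal l) (ℓ w)).scomp w hℓ
  have hd2 : HasDerivAt (fun z => NormedSpace.exp (ℓ z • R)) (w⁻¹ • (R * E₂)) w :=
    (hasDerivAt_exp_smul_const' R (ℓ w)).scomp w hℓ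
  refine ((hd.mul hd1).mul hd2).congr_deriv ?_
  have hd' : d = w⁻¹ • (w • d) := by rw [smul_smul, inv_mul_cancel₀ hw0, one_smul]
  have hode' : B w * Ψ w - Ψ w * diagonal l - Ψ w * ∑' n, w ^ n • Q n = w • d := by
    rw [← hode]
    abel
  calc (d * E₁ + Ψ w * w⁻¹ • (diagonal l * E₁)) * E₂ + Ψ w * E₁ * w⁻¹ • (R * E₂)
      = w⁻¹ • ((w • d) * E₁ * E₂ + Ψ w * (diagonal l * E₁) * E₂ + Ψ w * (E₁ * R) * E₂) := by
        nth_rw 1 [hd']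
        simp only [smul_add, add_mul, smul_mul_assoc, mul_smul_comm, mul_assoc]
    _ = w⁻¹ • (B w * (Ψ w * E₁ * E₂)) := by
        rw [hconj, ← hode']
        congr 1
        noncomm_ring
    _ = _ := by rw [smul_mul_assoc]

end LocalNormalForm

/-! ### Branches of the logarithm and slit discs. -/

namespace BranchCuts

variable {n : ℕ} {u : Fin n → ℂ} (c : BranchCuts u)

theorem exp_clog (p : ℤ) {w : ℂ} (hw : w ≠ 0) : Complex.exp (c.clog p w) = w := by
  have hd := c.dir_ne_zero
  rw [clog, Complex.exp_add, Complex.exp_add, Complex.exp_log (by simp [hw, hd]),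
    Complex.exp_log (by simpa using hd), mul_comm (2 * (Real.pi : ℂ) * Complex.I),
    Complex.exp_int_mul_two_pi_mul_I]
  field_simp

theorem hasDerivAt_clog (p : ℤ) {w : ℂ} (hw : (w / c.dir).im ≠ 0 ∨ (w / c.dir).re < 0) :
    HasDerivAt (c.clog p) w⁻¹ w := by
  have hd := c.dir_ne_zero
  have hw0 : w ≠ 0 := by
    rintro rfl
    simp at hw
  have hs : -w / c.dir ∈ Complex.slitPlane := by
    rw [neg_div, Complex.mem_slitPlane_iff]
    simpa [or_comm] using hw
  have h1 : HasDerivAt (fun w : ℂ => -w / c.dir) (-1 / c.dir) w :=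
    ((hasDerivAt_id w).neg).div_const _
  refine (((h1.clog hs).add_const _).add_const _).congr_deriv ?_
  field_simp

/-- Near `uₖ`, the plane without the cuts is a slit disc. -/
theorem exists_ball_inter_domain (k : Fin n) :
    ∃ r₀ > 0, ∀ r, r ≤ r₀ →
      ∀ z ∈ Metric.ball (u k) r, z ∈ c.domain ↔
        (((z - u k) / c.dir).im ≠ 0 ∨ ((z - u k) / c.dir).re < 0) := by
  have h : ∀ᶠ z in 𝓝 (u k), ∀ j, j ≠ k →
      ((z - u j) / c.dir).im ≠ 0 ∨ ((z - u j) / c.dir).re < 0 := by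
    rw [eventually_all]
    intro j
    by_cases hj : j = k
    · simp [hj]
    have hjk : ((u k - u j) / c.dir).im ≠ 0 ∨ ((u k - u j) / c.dir).re < 0 := by
      have : u k ∉ c.cut j := by
        rintro ⟨t, ht, h⟩
        exact c.generic k j (Ne.symm hj) t ht h
      rw [mem_cut_iff, not_and_or, not_le] at this
      exact this
    have hc : Continuous fun z : ℂ => (z - u j) / c.dir := by fun_prop
    have hopen : IsOpen ({z : ℂ | ((z - u j) / c.dir).im ≠ 0} ∪ {z | ((z - u j) / c.dir).re < 0}) :=
      (isOpen_ne_fun (Complex.continuous_im.comp hc) continuous_const).union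
        (isOpen_lt (Complex.continuous_re.comp hc) continuous_const)
    filter_upwards [hopen.mem_nhds hjk] with z hz _ using hz
  obtain ⟨r₀, hr₀, hb⟩ := Metric.eventually_nhds_iff_ball.1 h
  refine ⟨r₀, hr₀, fun r hr z hz => ?_⟩
  rw [mem_domain_iff]
  refine ⟨fun h => h k, fun h j => ?_⟩
  by_cases hj : j = k
  · rwa [hj]
  · exact hb z (Metric.ball_subset_ball hr hz) j hj

/-- Small slit discs around the poles are connected. -/
theorem exists_isConnected_ball_inter_domain (k : Fin n) :
    ∃ r₀ > 0, ∀ r, 0 < r → r ≤ r₀ → IsConnected (Metric.ball (u k) r ∩ c.domain) := by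
  obtain ⟨r₀, hr₀, h⟩ := c.exists_ball_inter_domain k
  refine ⟨r₀, hr₀, fun r hr hrr => ?_⟩
  have hd : 0 < ‖c.dir‖ := norm_pos_iff.2 c.dir_ne_zero
  set τ : ℝ := r / 2 / ‖c.dir‖ with hτ
  have hτ0 : 0 < τ := by positivity
  have hq : u k - τ * c.dir ∈ Metric.ball (u k) r := by
    rw [Metric.mem_ball, dist_eq_norm, sub_sub_cancel_left, norm_neg, norm_mul, Complex.norm_real,
      Real.norm_of_nonneg hτ0.le, hτ, div_mul_cancel₀ _ hd.ne']
    linarith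
  have hqd : (u k - τ * c.dir - u k) / c.dir = -τ := by
    rw [sub_sub_cancel_left, neg_div, mul_div_cancel_right₀ _ c.dir_ne_zero]
  have hq' : u k - τ * c.dir ∈ c.domain := by
    rw [h r hrr _ hq, hqd]
    simp [hτ0]
  -- The slit disc is star-shaped about a point on the prolongation of the cut beyond its endpoint.
  have hstar : StarConvex ℝ (u k - τ * c.dir) (Metric.ball (u k) r ∩ c.domain) := by
    rintro z ⟨hz, hz'⟩ a b ha hb hab
    have hmem := (convex_ball (u k) r) hq hz ha hb hab
    refine ⟨hmem, (h r hrr _ hmem).2 ?_⟩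
    have h1 : (a • (u k - τ * c.dir) + b • z - u k) / c.dir =
        ((-(a * τ) : ℝ) : ℂ) + (b : ℝ) * ((z - u k) / c.dir) := by
      have : u k = a * u k + b * u k := by
        rw [← add_mul, ← Complex.ofReal_add, hab, Complex.ofReal_one, one_mul]
      simp only [Complex.real_smul]
      rw [div_eq_iff c.dir_ne_zero, add_mul, mul_assoc, div_mul_cancel₀ _ c.dir_ne_zero]
      push_cast
      linear_combination -this
    rw [h1]
    simp only [Complex.add_im, Complex.add_re, Complex.ofReal_im, Complex.ofReal_re,
      Complex.im_ofReal_mul, Complex.re_ofReal_mul, zero_add]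
    rcases hb.eq_or_lt with rfl | hb'
    · right
      have : a = 1 := by linarith
      simp [this, hτ0]
    rcases (h r hrr z hz).1 hz' with h2 | h2
    · left
      exact mul_ne_zero hb'.ne' h2
    · right
      have : 0 ≤ a * τ := by positivity
      nlinarith
  exact (hstar.isPathConnected ⟨hq, hq'⟩).isConnected

theorem norm_lt_of_mem_lowerHalf {r : ℝ} {z : ℂ} (hz : z ∈ c.lowerHalf r) :
    r * ‖c.dir‖ < ‖z‖ := by
  have hd : 0 < ‖c.dir‖ := norm_pos_iff.2 c.dir_ne_zero
  rw [← lt_div_iff₀ hd, ← norm_div]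
  refine lt_of_lt_of_le ?_ (Complex.abs_re_le_norm _)
  rw [lt_abs]
  right
  simp only [lowerHalf, Set.mem_ofPred_eq] at hz
  linarith

end BranchCuts

/-- A matrix with simple spectrum is diagonalised by an invertible matrix. -/
theorem Matrix.exists_isUnit_mul_eq_mul_diagonal {m : ℕ} {A : Matrix (Fin m) (Fin m) ℂ}
    {l : Fin m → ℂ} (hA : A.charpoly.roots.Nodup)
    (hl : A.charpoly.roots = Finset.univ.val.map l) :
    ∃ Q : Matrix (Fin m) (Fin m) ℂ, IsUnit Q ∧ A * Q = Q * diagonal l := by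
  have hinj : Function.Injective l := by
    rw [hl] at hA
    have := Multiset.inj_on_of_nodup_map hA
    exact fun i j h => this i (Finset.mem_univ i) j (Finset.mem_univ j) h
  have hv : ∀ i, ∃ v : Fin m → ℂ, Module.End.HasEigenvector (Matrix.toLin' A) (l i) v := by
    intro i
    have h1 : l i ∈ A.charpoly.roots := by
      rw [hl]
      exact Multiset.mem_map_of_mem _ (Finset.mem_univ i)
    have h2 : Module.End.HasEigenvalue (Matrix.toLin' A) (l i) := by
      rw [Module.End.hasEigenvalue_iff_isRoot_charpoly, Matrix.charpoly_toLin']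
      exact Polynomial.isRoot_of_mem_roots h1
    exact h2.exists_hasEigenvector
  choose v hv using hv
  have hli : LinearIndependent ℂ v :=
    Module.End.eigenvectors_linearIndependent' (Matrix.toLin' A) l hinj v hv
  refine ⟨(Matrix.of v)ᵀ, ?_, ?_⟩
  · rw [Matrix.isUnit_transpose]
    exact Matrix.linearIndependent_rows_iff_isUnit.1 hli
  · ext i j
    have := congrFun (hv j).apply_eq_smul i
    rw [Matrix.mul_diagonal]
    simpa [Matrix.mul_apply, Matrix.mulVec, dotProduct, mul_comm] using this

/-! ### Existence of Levelt solutions and of monodromy data. -/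

namespace FuchsianSystem

variable {n m : ℕ} {u : Fin n → ℂ} (S : FuchsianSystem m u)

/-- Local solutions at the poles are continued by fundamental matrices on the whole domain. -/
theorem IsFundamental.exists_isUnit_eq_mul {S : FuchsianSystem m u} {c : BranchCuts u}
    {Φ : ℂ → Matrix (Fin m) (Fin m) ℂ} (hΦ : S.IsFundamental c Φ) {W : Set ℂ} (hW : IsOpen W)
    (hWc : IsConnected W) (hWd : W ⊆ c.domain) {F : ℂ → Matrix (Fin m) (Fin m) ℂ}
    (hF : ∀ z ∈ W, HasDerivAt F (S.coeff z * F z) z) (hFu : ∀ z ∈ W, IsUnit (F z)) :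
    ∃ M : Matrix (Fin m) (Fin m) ℂ, IsUnit M ∧ ∀ z ∈ W, F z = Φ z * M := by
  rw [isFundamental_iff] at hΦ
  obtain ⟨M, hM⟩ := exists_eq_mul_of_solutions hW hWc.isPreconnected
    (fun z hz => hΦ.1 z (hWd hz)) (fun z hz => hΦ.2 z (hWd hz)) hF
  refine ⟨M, ?_, hM⟩
  obtain ⟨q, hq⟩ := hWc.nonempty
  have h1 := hFu q hq
  rw [hM q hq] at h1
  obtain ⟨x, hx⟩ := hΦ.2 q (hWd hq)
  rw [← hx] at h1
  exact (Units.isUnit_units_mul x M).1 h1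

/-- Existence of Levelt fundamental matrices at the finite poles. -/
theorem exists_isLeveltAt (c : BranchCuts u) {Φ : ℂ → Matrix (Fin m) (Fin m) ℂ}
    (hu : Function.Injective u)
    (hΦ : S.IsFundamental c Φ) (k : Fin n) {l : Fin m → ℂ}
    (hl : (S.A k).charpoly.roots = Finset.univ.val.map l) :
    ∃ (M R : Matrix (Fin m) (Fin m) ℂ), IsUnit M ∧ S.IsLeveltAt c k l R fun z => Φ z * M := by
  obtain ⟨Q, hQ, hAQ⟩ := Matrix.exists_isUnit_mul_eq_mul_diagonal (S.distinct k) hl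
  set Q' := Ring.inverse Q with hQ'
  have hQQ' : Q * Q' = 1 := Ring.mul_inverse_cancel _ hQ
  have hQ'Q : Q' * Q = 1 := Ring.inverse_mul_cancel _ hQ
  -- Away from `w = 0` this is `w` times the coefficient matrix at `w + u k`, written in an
  -- eigenbasis of `S.A k`, so that its value at `0` is diagonal.
  set B : ℂ → Matrix (Fin m) (Fin m) ℂ := fun w =>
    Q' * (S.A k + w • ∑ j ∈ Finset.univ.erase k, (w + u k - u j)⁻¹ • S.A j) * Q with hB
  have hBan : AnalyticAt ℂ B 0 := by
    have h1 : AnalyticAt ℂ (fun w : ℂ => ∑ j ∈ Finset.univ.erase k,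
        (w + u k - u j)⁻¹ • S.A j) 0 := by
      refine Finset.analyticAt_fun_sum _ fun j hj => ?_
      have hne : (0 : ℂ) + u k - u j ≠ 0 := by
        rw [zero_add]
        exact sub_ne_zero.2 fun h => Finset.ne_of_mem_erase hj (hu h).symm
      exact AnalyticAt.smul (AnalyticAt.inv (f := fun w : ℂ => w + u k - u j) (by fun_prop) hne) analyticAt_const
    exact (analyticAt_const.mul (analyticAt_const.add (analyticAt_id.smul h1))).mul analyticAt_const
  have hB0 : B 0 = diagonal l := by
    simp only [hB, zero_smul, add_zero]
    rw [mul_assoc, hAQ, ← mul_assoc, hQ'Q, one_mul]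
  have hBw : ∀ w : ℂ, w ≠ 0 → Q * (w⁻¹ • B w) = S.coeff (w + u k) * Q := by
    intro w hw
    simp only [hB, coeff]
    rw [← Finset.add_sum_erase _ _ (Finset.mem_univ k), mul_smul_comm, ← mul_assoc, ← mul_assoc,
      hQQ', one_mul, ← smul_mul_assoc, smul_add, smul_smul, inv_mul_cancel₀ hw, one_smul,
      add_sub_cancel_right]
  obtain ⟨Ψ, R, hΨ, hΨ0, hadm, ε, hε, hloc⟩ := exists_local_levelt hBan hB0
  obtain ⟨r₀, hr₀, hconn⟩ := c.exists_isConnected_ball_inter_domain k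
  set r := min r₀ ε with hr
  have hrpos : 0 < r := lt_min hr₀ hε
  set F : ℂ → Matrix (Fin m) (Fin m) ℂ := fun z => Q * Ψ (z - u k) *
    NormedSpace.exp (c.logAt k z • diagonal l) * NormedSpace.exp (c.logAt k z • R) with hF
  have hsmall : ∀ z ∈ Metric.ball (u k) r ∩ c.domain, z - u k ≠ 0 ∧ ‖z - u k‖ < ε := fun z hz =>
    ⟨sub_ne_zero.2 (c.ne_of_mem_domain hz.2 k),
      (by simpa [dist_eq_norm] using hz.1 : ‖z - u k‖ < r).trans_le (min_le_right _ _)⟩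
  obtain ⟨M, hM, hFM⟩ := hΦ.exists_isUnit_eq_mul (Metric.isOpen_ball.inter c.isOpen_domain)
    (hconn r hrpos (min_le_left _ _)) Set.inter_subset_right (F := F) (by
      intro z hz
      obtain ⟨hz0, hzε⟩ := hsmall z hz
      have h1 := (hloc (z - u k) hz0 hzε).2 (c.clog (c.branch k))
        (c.hasDerivAt_clog _ ((c.mem_domain_iff z).1 hz.2 k)) (c.exp_clog _ hz0)
      have h2 := (h1.comp_sub_const z (u k)).const_mul Q
      rw [← mul_assoc, hBw _ hz0, sub_add_cancel, mul_assoc] at h2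
      refine (h2.congr_of_eventuallyEq (Eventually.of_forall fun y => ?_)).congr_deriv ?_ <;>
        simp only [hF, BranchCuts.logAt, mul_assoc]) (by
      intro z hz
      obtain ⟨hz0, hzε⟩ := hsmall z hz
      exact ((hQ.mul (hloc _ hz0 hzε).1).mul (Matrix.isUnit_exp _)).mul (Matrix.isUnit_exp _))
  refine ⟨M, R, hM, hΦ.mul_isUnit hM, hadm, fun z => Q * Ψ (z - u k), ?_, ?_, ?_⟩
  · rw [← Matrix.analyticAt_iff_entries]
    refine analyticAt_const.mul (AnalyticAt.fun_comp ?_ (by fun_prop))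
    simpa using hΨ
  · simp only [sub_self, hΨ0, mul_one]
    exact ((Matrix.isUnit_iff_isUnit_det _).1 hQ).ne_zero
  · filter_upwards [self_mem_nhdsWithin,
      nhdsWithin_le_nhds (Metric.ball_mem_nhds (u k) hrpos)] with z hz1 hz2
    exact (hFM z ⟨hz2, hz1⟩).symm

/-- Existence of the Levelt fundamental matrix at infinity. -/
theorem exists_isLeveltInf (c : BranchCuts u) {Φ : ℂ → Matrix (Fin m) (Fin m) ℂ}
    (hΦ : S.IsFundamental c Φ) :
    ∃ (M R : Matrix (Fin m) (Fin m) ℂ), IsUnit M ∧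
      S.IsLeveltInf c S.AInf.diag R fun z => Φ z * M := by
  -- In the parameter `w = 1/z` the system becomes `dΦ/dw = w⁻¹ B(w) Φ` with `B 0 = A_∞`. This is
  -- already diagonal, so no change of basis spoils `Ψ 0 = 1`. The logarithm of `w` is `-log z`,
  -- whence the signs below.
  set B : ℂ → Matrix (Fin m) (Fin m) ℂ := fun w => -∑ k, (1 - u k * w)⁻¹ • S.A k with hB
  have hBan : AnalyticAt ℂ B 0 := by
    refine AnalyticAt.neg (Finset.analyticAt_fun_sum _ fun j _ => ?_)
    exact AnalyticAt.smul (AnalyticAt.inv (f := fun w : ℂ => 1 - u j * w) (by fun_prop) (by simp)) analyticAt_const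
  have hB0 : B 0 = diagonal S.AInf.diag := by
    rw [AInf, (Matrix.isDiag_iff_diagonal_diag _).1 S.isDiag_inf]
    simp [hB]
  obtain ⟨Ψ, R, hΨ, hΨ0, hadm, ε, hε, hloc⟩ := exists_local_levelt hBan hB0
  obtain ⟨r₀, hr₀⟩ := c.exists_lowerHalf_subset
  have hd : 0 < ‖c.dir‖ := norm_pos_iff.2 c.dir_ne_zero
  set r := max r₀ (1 / (ε * ‖c.dir‖)) with hr
  have hrpos : 0 < r := lt_max_of_lt_right (by positivity)
  have hsub := hr₀ r (le_max_left _ _)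
  have hsmall : ∀ z ∈ c.lowerHalf r, z ≠ 0 ∧ ‖z⁻¹‖ < ε := by
    intro z hz
    have h1 := c.norm_lt_of_mem_lowerHalf hz
    have h2 : ε⁻¹ ≤ r * ‖c.dir‖ := by
      calc ε⁻¹ = 1 / (ε * ‖c.dir‖) * ‖c.dir‖ := by field_simp
        _ ≤ _ := by gcongr; exact le_max_right _ _
    have hz0 : z ≠ 0 := norm_pos_iff.1 ((by positivity : 0 ≤ r * ‖c.dir‖).trans_lt h1)
    refine ⟨hz0, ?_⟩
    rw [norm_inv]
    exact inv_lt_of_inv_lt₀ hε (h2.trans_lt h1)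
  set F : ℂ → Matrix (Fin m) (Fin m) ℂ := fun z => Ψ z⁻¹ *
    NormedSpace.exp (-c.logInf z • diagonal S.AInf.diag) * NormedSpace.exp (-c.logInf z • R) with hF
  have hconn : IsConnected (c.lowerHalf r) :=
    ⟨let ⟨_, _, h⟩ := c.exists_sub_mem_lowerHalf 0 r; ⟨_, h⟩,
      (c.convex_lowerHalf r).isPreconnected⟩
  obtain ⟨M, hM, hFM⟩ := hΦ.exists_isUnit_eq_mul (c.isOpen_lowerHalf r) hconn hsub (F := F) (by
      intro z hz
      obtain ⟨hz0, hzε⟩ := hsmall z hz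
      have hlog : HasDerivAt (fun w => -c.logInf w⁻¹) (z⁻¹)⁻¹ z⁻¹ := by
        have h0 : HasDerivAt c.logInf z⁻¹ z := by
          refine c.hasDerivAt_clog _ (Or.inr ?_)
          simp only [BranchCuts.lowerHalf, Set.mem_ofPred_eq] at hz
          linarith
        rw [← inv_inv z] at h0
        refine (h0.comp z⁻¹ (hasDerivAt_inv (inv_ne_zero hz0))).neg.congr_deriv ?_
        field_simp
      have h1 := (hloc z⁻¹ (inv_ne_zero hz0) hzε).2 (fun w => -c.logInf w⁻¹) hlog (by
        simp only [inv_inv]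
        rw [Complex.exp_neg, BranchCuts.logInf, c.exp_clog _ hz0])
      have h2 := HasDerivAt.scomp z h1 (hasDerivAt_inv hz0)
      simp only [Function.comp_def, inv_inv] at h2
      refine h2.congr_deriv ?_
      rw [← smul_mul_assoc, smul_smul]
      congr 1
      simp only [hB, coeff, ← Finset.sum_neg_distrib, ← neg_smul, Finset.smul_sum, smul_smul]
      refine Finset.sum_congr rfl fun k _ => ?_
      congr 1
      have hk : z - u k ≠ 0 := sub_ne_zero.2 (c.ne_of_mem_domain (hsub hz) k)
      have hk' : 1 - u k * z⁻¹ ≠ 0 := by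
        field_simp
        exact div_ne_zero hk hz0
      field_simp) (by
      intro z hz
      obtain ⟨hz0, hzε⟩ := hsmall z hz
      exact (((hloc _ (inv_ne_zero hz0) hzε).1).mul (Matrix.isUnit_exp _)).mul
        (Matrix.isUnit_exp _))
  refine ⟨M, R, hM, hΦ.mul_isUnit hM, hadm, Ψ, Matrix.analyticAt_iff_entries.1 hΨ, hΨ0, r,
    fun z hz => (hFM z hz).symm⟩

/-- Every system has monodromy data, for every ordering of the eigenvalues. -/
theorem exists_realizes (hu : Function.Injective u) (c : BranchCuts u) {lam : Fin n → Fin m → ℂ}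
    (hlam : S.IsEigenvalueOrdering lam) :
    ∃ d : MonodromyCollection n m, d.lam = lam ∧ S.Realizes c d := by
  obtain ⟨Φ, hΦ⟩ := S.exists_isFundamental c
  choose M R hM hL using fun k => S.exists_isLeveltAt c hu hΦ k (hlam k)
  obtain ⟨MInf, RInf, hMInf, hLInf⟩ := S.exists_isLeveltInf c hΦ
  refine ⟨⟨lam, R, S.AInf.diag, RInf, fun k => Ring.inverse (M k) * MInf⟩, rfl, rfl,
    fun k z => Φ z * M k, fun z => Φ z * MInf, hL, hLInf, fun k z _ => ?_⟩
  rw [mul_assoc, ← mul_assoc (M k), Ring.mul_inverse_cancel _ (hM k), one_mul]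

end FuchsianSystem

/-! ### The groups `𝒞₀(Λ)` and equivalence of collections. -/

section Groups

variable {m : ℕ} {l : Fin m → ℂ}

theorem RaisesSpectrum.mul {M N : Matrix (Fin m) (Fin m) ℂ} (hM : RaisesSpectrum l M)
    (hN : RaisesSpectrum l N) : RaisesSpectrum l (M * N) := by
  intro i j hij
  rw [Matrix.mul_apply] at hij
  obtain ⟨p, -, hp⟩ := Finset.exists_ne_zero_of_sum_ne_zero hij
  obtain ⟨a, ha⟩ := hM i p (left_ne_zero_of_mul hp)
  obtain ⟨b, hb⟩ := hN p j (right_ne_zero_of_mul hp)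
  refine ⟨b + a, ?_⟩
  rw [ha, hb]
  push_cast
  ring

theorem raisesSpectrum_diagonal (g : Fin m → ℂ) : RaisesSpectrum l (diagonal g) := by
  intro i j hij
  obtain rfl : i = j := by
    by_contra h
    exact hij (Matrix.diagonal_apply_ne _ h)
  exact ⟨0, by simp⟩

theorem mul_mem_groupC0 {G G' : GL (Fin m) ℂ} (hG : G ∈ groupC0 l) (hG' : G' ∈ groupC0 l) :
    G * G' ∈ groupC0 l :=
  RaisesSpectrum.mul hG hG'

theorem one_mem_groupC0 : (1 : GL (Fin m) ℂ) ∈ groupC0 l := by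
  have := raisesSpectrum_diagonal (l := l) (fun _ => 1)
  rwa [Matrix.diagonal_one] at this

theorem IsAdmissiblePair.conj_diagonal {R : Matrix (Fin m) (Fin m) ℂ} (h : IsAdmissiblePair l R)
    {D : GL (Fin m) ℂ} {g g' : Fin m → ℂ} (hD : D.val = diagonal g)
    (hD' : (D⁻¹).val = diagonal g') :
    IsAdmissiblePair l ((D⁻¹).val * R * D.val) := by
  have hr : RaisesSpectrum l ((D⁻¹).val * R * D.val) := by
    rw [hD, hD']
    exact ((raisesSpectrum_diagonal g').mul h.2.2).mul (raisesSpectrum_diagonal g)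
  refine ⟨?_, hr.commute_exp, hr⟩
  obtain ⟨n, hn⟩ := h.1
  exact ⟨n, by rw [Units.conj_pow', hn, mul_zero, zero_mul]⟩

theorem Matrix.exp_smul_conj (D : GL (Fin m) ℂ) (ζ : ℂ) (R : Matrix (Fin m) (Fin m) ℂ) :
    D.val * NormedSpace.exp (ζ • ((D⁻¹).val * R * D.val)) = NormedSpace.exp (ζ • R) * D.val := by
  have h : ζ • ((D⁻¹).val * R * D.val) = (D⁻¹).val * (ζ • R) * D.val := by
    rw [mul_smul_comm, smul_mul_assoc]
  rw [h, Matrix.exp_units_conj' D (ζ • R), ← mul_assoc, ← mul_assoc, ← Units.val_mul,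
    mul_inv_cancel, Units.val_one, one_mul]

/-- The invertible diagonal matrix with given nonzero entries. -/
def diagonalUnit (g : Fin m → ℂ) (hg : ∀ i, g i ≠ 0) : GL (Fin m) ℂ where
  val := diagonal g
  inv := diagonal fun i => (g i)⁻¹
  val_inv := by simp [Matrix.diagonal_mul_diagonal, hg]
  inv_val := by simp [Matrix.diagonal_mul_diagonal, hg]

end Groups

namespace MonodromyCollection

variable {n m : ℕ}

theorem Equivalent.refl (d : MonodromyCollection n m) : d.Equivalent d :=
  ⟨fun _ => 1, 1, fun _ => one_mem_groupC0, one_mem_groupC0, rfl, rfl, by simp, by simp, by simp⟩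

theorem Equivalent.trans {d d' d'' : MonodromyCollection n m} (h : d.Equivalent d')
    (h' : d'.Equivalent d'') : d.Equivalent d'' := by
  obtain ⟨G, GI, hG, hGI, h1, h2, h3, h4, h5⟩ := h
  obtain ⟨G', GI', hG', hGI', h1', h2', h3', h4', h5'⟩ := h'
  rw [h1] at hG'
  rw [h2] at hGI'
  refine ⟨fun k => G k * G' k, GI * GI', fun k => mul_mem_groupC0 (hG k) (hG' k),
    mul_mem_groupC0 hGI hGI', h1'.trans h1, h2'.trans h2, fun k => ?_, ?_, fun k => ?_⟩
  · simp only [h3', h3, _root_.mul_inv_rev, Units.val_mul, mul_assoc]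
  · simp only [h4', h4, _root_.mul_inv_rev, Units.val_mul, mul_assoc]
  · simp only [h5', h5, _root_.mul_inv_rev, Units.val_mul, mul_assoc]

end MonodromyCollection

/-! ### Diagonal conjugation preserves the monodromy data. -/

namespace FuchsianSystem

variable {n m : ℕ} {u : Fin n → ℂ} {S₁ S₂ : FuchsianSystem m u}

section Conjugation

variable {D : GL (Fin m) ℂ}

theorem coeff_conj (hA : ∀ k, S₂.A k = (D⁻¹).val * S₁.A k * D.val)
    (z : ℂ) : S₂.coeff z = (D⁻¹).val * S₁.coeff z * D.val := by
  simp only [coeff, hA, Finset.mul_sum, Finset.sum_mul, mul_smul_comm, smul_mul_assoc]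

theorem IsFundamental.conj (hA : ∀ k, S₂.A k = (D⁻¹).val * S₁.A k * D.val)
    {c : BranchCuts u} {Φ : ℂ → Matrix (Fin m) (Fin m) ℂ}
    (h : S₁.IsFundamental c Φ) : S₂.IsFundamental c fun z => (D⁻¹).val * Φ z := by
  rw [isFundamental_iff] at *
  refine ⟨fun z hz => ?_, fun z hz => (Units.isUnit D⁻¹).mul (h.2 z hz)⟩
  refine ((h.1 z hz).const_mul (D⁻¹).val).congr_deriv ?_
  rw [coeff_conj hA]
  simp only [mul_assoc, Units.mul_inv_cancel_left]

theorem IsLeveltAt.conj (hA : ∀ k, S₂.A k = (D⁻¹).val * S₁.A k * D.val)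
    {c : BranchCuts u} {k : Fin n} {l : Fin m → ℂ}
    {R : Matrix (Fin m) (Fin m) ℂ} {Φ : ℂ → Matrix (Fin m) (Fin m) ℂ}
    (h : S₁.IsLeveltAt c k l R Φ) : S₂.IsLeveltAt c k l R fun z => (D⁻¹).val * Φ z := by
  obtain ⟨hf, hadm, Ψ, hΨ, hdet, hev⟩ := h
  refine ⟨hf.conj hA, hadm, fun z => (D⁻¹).val * Ψ z, ?_, ?_, ?_⟩
  · rw [← Matrix.analyticAt_iff_entries] at *
    exact analyticAt_const.mul hΨ
  · rw [Matrix.det_mul]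
    exact mul_ne_zero ((Matrix.isUnit_iff_isUnit_det _).1 (Units.isUnit D⁻¹)).ne_zero hdet
  · filter_upwards [hev] with z hz
    rw [hz]
    simp only [mul_assoc]

theorem IsLeveltInf.conj (hA : ∀ k, S₂.A k = (D⁻¹).val * S₁.A k * D.val)
    {g g' : Fin m → ℂ} (hD : D.val = diagonal g)
    (hD' : (D⁻¹).val = diagonal g') {c : BranchCuts u} {l : Fin m → ℂ}
    {R : Matrix (Fin m) (Fin m) ℂ} {Φ : ℂ → Matrix (Fin m) (Fin m) ℂ}
    (h : S₁.IsLeveltInf c l R Φ) :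
    S₂.IsLeveltInf c l ((D⁻¹).val * R * D.val) fun z => (D⁻¹).val * Φ z * D.val := by
  obtain ⟨hf, hadm, Ψ, hΨ, hΨ0, r, hr⟩ := h
  refine ⟨(hf.conj hA).mul_isUnit D.isUnit, hadm.conj_diagonal hD hD',
    fun z => (D⁻¹).val * Ψ z * D.val, ?_, ?_, r, fun z hz => ?_⟩
  · rw [← Matrix.analyticAt_iff_entries] at *
    exact (analyticAt_const.mul hΨ).mul analyticAt_const
  · simp [hΨ0]
  · have h1 : ∀ E : Matrix (Fin m) (Fin m) ℂ,
        D.val * (NormedSpace.exp (-c.logInf z • diagonal l) * E) =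
          NormedSpace.exp (-c.logInf z • diagonal l) * (D.val * E) := by
      intro E
      rw [← mul_assoc, ← mul_assoc]
      congr 1
      rw [hD, Matrix.exp_smul_diagonal, Matrix.diagonal_mul_diagonal, Matrix.diagonal_mul_diagonal]
      simp only [mul_comm]
    beta_reduce
    rw [hr z hz]
    simp only [mul_assoc, h1]
    rw [← mul_assoc (D⁻¹).val R, Matrix.exp_smul_conj]

/-- Conjugate systems have the same monodromy data. -/
theorem monodromyData_subset_of_conj (hA : ∀ k, S₂.A k = (D⁻¹).val * S₁.A k * D.val)
    {g g' : Fin m → ℂ} (hD : D.val = diagonal g)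
    (hD' : (D⁻¹).val = diagonal g') (hInf : S₁.AInf = S₂.AInf) (c : BranchCuts u)
    (lam : Fin n → Fin m → ℂ) : S₁.monodromyData c lam ⊆ S₂.monodromyData c lam := by
  rintro d ⟨d₀, hd₀, ⟨hlamInf, Φ, ΦInf, hΦ, hΦInf, hC⟩, heq⟩
  -- The transformed solutions realize this collection, and `G_∞ = D⁻¹`, `Gₖ = 1` lead from it back
  -- to `d₀`.
  refine ⟨⟨d₀.lam, d₀.R, d₀.lamInf, (D⁻¹).val * d₀.RInf * D.val, fun k => d₀.C k * D.val⟩, hd₀,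
    ⟨hInf ▸ hlamInf, fun k z => (D⁻¹).val * Φ k z, fun z => (D⁻¹).val * ΦInf z * D.val,
      fun k => (hΦ k).conj hA, hΦInf.conj hA hD hD', fun k z hz => ?_⟩,
    MonodromyCollection.Equivalent.trans ?_ heq⟩
  · simp only [hC k z hz, mul_assoc]
  · refine ⟨fun _ => 1, D⁻¹, fun _ => one_mem_groupC0, ?_, rfl, rfl, by simp, ?_, fun k => ?_⟩
    · change RaisesSpectrum _ _
      rw [hD']
      exact raisesSpectrum_diagonal g'
    · simp only [mul_assoc, inv_inv, Units.mul_inv, mul_one, Units.mul_inv_cancel_left]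
    · simp only [inv_one, Units.val_one, one_mul, mul_assoc, Units.mul_inv, mul_one]

theorem isEigenvalueOrdering_of_conj (hA : ∀ k, S₂.A k = (D⁻¹).val * S₁.A k * D.val)
    {lam : Fin n → Fin m → ℂ} (h : S₁.IsEigenvalueOrdering lam) :
    S₂.IsEigenvalueOrdering lam := by
  intro k
  rw [hA k, Matrix.coe_units_inv, Matrix.charpoly_units_conj']
  exact h k

end Conjugation

end FuchsianSystem

/-! ### Entire extensions and a Liouville argument. -/

section Extension

variable {E : Type*} [NormedAddCommGroup E] [NormedSpace ℂ E] [CompleteSpace E]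

/-- A function on a dense set that is locally the restriction of analytic functions extends to an
entire function. -/
theorem Dense.exists_entire_extension {Ω : Set ℂ} (hΩ : Dense Ω) {Y : ℂ → E}
    (h : ∀ p, ∃ F : ℂ → E, AnalyticAt ℂ F p ∧ ∀ᶠ z in 𝓝[Ω] p, Y z = F z) :
    ∃ F : ℂ → E, Differentiable ℂ F ∧ ∀ z ∈ Ω, Y z = F z := by
  -- By density, the extension by limits coincides near `p` with any continuous local extension, so
  -- the local pieces need no separate compatibility check.
  have key : ∀ p, ∃ F : ℂ → E, AnalyticAt ℂ F p ∧ (∀ᶠ z in 𝓝[Ω] p, Y z = F z) ∧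
      ∀ᶠ q in 𝓝 p, extendFrom Ω Y q = F q := by
    intro p
    obtain ⟨F, hF, hYF⟩ := h p
    refine ⟨F, hF, hYF, ?_⟩
    filter_upwards [eventually_eventually_nhds.2 (eventually_nhdsWithin_iff.1 hYF),
      hF.eventually_analyticAt] with q hq hFq
    replace hq := eventually_nhdsWithin_iff.2 hq
    refine extendFrom_eq (hΩ q) ?_
    exact (hFq.continuousAt.tendsto.mono_left nhdsWithin_le_nhds).congr'
      (hq.mono fun z hz => hz.symm)
  refine ⟨extendFrom Ω Y, fun p => ?_, fun z hz => ?_⟩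
  · obtain ⟨F, hF, -, hext⟩ := key p
    exact hF.differentiableAt.congr_of_eventuallyEq hext
  · obtain ⟨F, -, hYF, hext⟩ := key z
    rw [hext.self_of_nhds, hYF.self_of_nhdsWithin hz]

theorem isPreconnected_setOf_lt_norm {ρ : ℝ} (hρ : 0 < ρ) : IsPreconnected {z : ℂ | ρ < ‖z‖} := by
  have : {z : ℂ | ρ < ‖z‖} = Complex.exp '' {z | Real.log ρ < z.re} := by
    ext z
    simp only [Set.mem_ofPred_eq, Set.mem_image]
    constructor
    · intro hz
      refine ⟨Complex.log z, ?_, Complex.exp_log (norm_pos_iff.1 (hρ.trans hz))⟩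
      rw [Complex.log_re]
      exact Real.log_lt_log hρ hz
    · rintro ⟨w, hw, rfl⟩
      rw [Complex.norm_exp]
      exact (Real.log_lt_iff_lt_exp hρ).1 hw
  rw [this]
  exact ((convex_halfSpace_re_gt _).isPreconnected).image _ Complex.continuous_exp.continuousOn

/-- An entire function that agrees near a sequence of points going to infinity with an analytic
function of `1/z` is constant. -/
theorem Differentiable.eq_const_of_eq_comp_inv {F H : ℂ → E} (hF : Differentiable ℂ F)
    (hH : AnalyticAt ℂ H 0) (h : ∀ ρ : ℝ, ∃ z, ρ < ‖z‖ ∧ ∀ᶠ w in 𝓝 z, F w = H w⁻¹) (z : ℂ) :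
    F z = H 0 := by
  obtain ⟨ε, hε, hball⟩ := Metric.eventually_nhds_iff.1 hH.eventually_analyticAt
  have hU : IsOpen {z : ℂ | ε⁻¹ < ‖z‖} := isOpen_lt continuous_const continuous_norm
  obtain ⟨z₀, hz₀, heq⟩ := h ε⁻¹
  -- The exterior of a disc is connected, so agreement near one point spreads to a full
  -- neighbourhood of infinity and `F` tends to `H 0` there.
  have hEq : Set.EqOn F (fun w => H w⁻¹) {z : ℂ | ε⁻¹ < ‖z‖} := by
    refine AnalyticOnNhd.eqOn_of_preconnected_of_eventuallyEq (z₀ := z₀)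
      (fun z _ => hF.analyticAt z) (fun z hz => ?_)
      (isPreconnected_setOf_lt_norm (inv_pos.2 hε)) hz₀ heq
    have hz' : ε⁻¹ < ‖z‖ := hz
    have hz0 : z ≠ 0 := norm_pos_iff.1 ((inv_pos.2 hε).trans hz')
    have h1 : AnalyticAt ℂ H z⁻¹ := hball (by
      rw [dist_zero_right, norm_inv]
      exact inv_lt_of_inv_lt₀ hε hz')
    exact AnalyticAt.fun_comp (g := H) (f := fun w : ℂ => w⁻¹) h1 (analyticAt_id.inv hz0)
  refine hF.apply_eq_of_tendsto_cocompact z ?_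
  rw [← Metric.cobounded_eq_cocompact]
  refine (hH.continuousAt.tendsto.comp tendsto_inv₀_cobounded).congr' ?_
  filter_upwards [tendsto_norm_cobounded_atTop.eventually_gt_atTop ε⁻¹] with w hw
  exact (hEq hw).symm

end Extension

/-- For `M` raising the spectrum of `Λ`, the conjugate `z^Λ M z^{-Λ}` is polynomial in `z`. -/
theorem RaisesSpectrum.exists_polynomial_conj {m : ℕ} {l : Fin m → ℂ}
    {M : Matrix (Fin m) (Fin m) ℂ} (h : RaisesSpectrum l M) :
    ∃ P : ℂ → Matrix (Fin m) (Fin m) ℂ, Differentiable ℂ P ∧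
      (∀ i j, l i ≠ l j → P 0 i j = 0) ∧
      ∀ ζ : ℂ, NormedSpace.exp (ζ • diagonal l) * M =
        P (Complex.exp ζ) * NormedSpace.exp (ζ • diagonal l) := by
  have h' : ∀ i j, ∃ k : ℕ, M i j ≠ 0 → l i = l j + k := by
    intro i j
    by_cases hij : M i j = 0
    · exact ⟨0, fun h => absurd hij h⟩
    · obtain ⟨k, hk⟩ := h i j hij
      exact ⟨k, fun _ => hk⟩
  choose k hk using h'
  refine ⟨fun w => Matrix.of fun i j => w ^ k i j * M i j, fun w => ?_, fun i j hij => ?_,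
    fun ζ => ?_⟩
  · rw [Matrix.differentiableAt_iff_entries]
    intro i j
    simp only [Matrix.of_apply]
    fun_prop
  · simp only [Matrix.of_apply]
    by_cases hM : M i j = 0
    · simp [hM]
    -- A nonzero entry between different eigenvalues carries a positive power of `w`, which vanishes
    -- at `0`.
    · have : k i j ≠ 0 := fun h0 => hij (by simpa [h0] using hk i j hM)
      simp [this]
  · ext i j
    rw [Matrix.exp_smul_diagonal, Matrix.diagonal_mul, Matrix.mul_diagonal]
    simp only [Matrix.of_apply]
    by_cases hM : M i j = 0
    · simp [hM]
    rw [hk i j hM, mul_add, Complex.exp_add, mul_comm ζ (k i j : ℂ), Complex.exp_nat_mul]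
    ring

theorem AnalyticAt.ringInverse {A : Type*} [NormedRing A] [NormedAlgebra ℂ A] [CompleteSpace A]
    {f : ℂ → A} {z : ℂ} (hf : AnalyticAt ℂ f z) (hu : IsUnit (f z)) :
    AnalyticAt ℂ (fun w => Ring.inverse (f w)) z := by
  obtain ⟨x, hx⟩ := hu
  exact AnalyticAt.fun_comp (g := Ring.inverse) (hx ▸ analyticAt_inverse x) hf

/-- Two Levelt-type normal forms with the same exponents and conjugate nilpotent parts differ by a
left factor that is analytic in the local parameter. -/
theorem levelt_quotient {m : ℕ} {l : Fin m → ℂ} {G : GL (Fin m) ℂ}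
    {R X Y : Matrix (Fin m) (Fin m) ℂ} (hX : IsUnit X) {P : ℂ → Matrix (Fin m) (Fin m) ℂ} {ζ : ℂ}
    (hP : NormedSpace.exp (ζ • diagonal l) * G.val =
      P (Complex.exp ζ) * NormedSpace.exp (ζ • diagonal l)) :
    Y * NormedSpace.exp (ζ • diagonal l) * NormedSpace.exp (ζ • R) * G.val =
      (Y * P (Complex.exp ζ) * Ring.inverse X) * (X * NormedSpace.exp (ζ • diagonal l) *
        NormedSpace.exp (ζ • ((G⁻¹).val * R * G.val))) := by
  rw [mul_assoc _ _ G.val, ← Matrix.exp_smul_conj, ← mul_assoc, mul_assoc Y _ G.val, hP]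
  simp only [← mul_assoc]
  rw [mul_assoc _ (Ring.inverse X) X, Ring.inverse_mul_cancel _ hX, mul_one]

/-! ### Half-strips around the cuts. -/

namespace BranchCuts

variable {n : ℕ} {u : Fin n → ℂ} (c : BranchCuts u)

/-- The half-strip of half-width `δ` around the cut starting at `uₖ`. -/
def strip (k : Fin n) (δ : ℝ) : Set ℂ :=
  {w | ((w - u k) / c.dir).im < δ ∧ -((w - u k) / c.dir).im < δ ∧ 0 < ((w - u k) / c.dir).re}

theorem isOpen_strip (k : Fin n) (δ : ℝ) : IsOpen (c.strip k δ) := by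
  have hc : Continuous fun z : ℂ => (z - u k) / c.dir := by fun_prop
  have h1 := Complex.continuous_im.comp hc
  have h2 := Complex.continuous_re.comp hc
  exact (isOpen_lt h1 continuous_const).inter
    ((isOpen_lt h1.neg continuous_const).inter (isOpen_lt continuous_const h2))

theorem combo_sub_div (k : Fin n) (z w : ℂ) {a b : ℝ} (hab : a + b = 1) :
    (a • z + b • w - u k) / c.dir = a * ((z - u k) / c.dir) + b * ((w - u k) / c.dir) := by
  have : u k = a * u k + b * u k := by
    rw [← add_mul, ← Complex.ofReal_add, hab, Complex.ofReal_one, one_mul]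
  nth_rw 1 [this]
  simp only [Complex.real_smul]
  ring

theorem convex_strip (k : Fin n) (δ : ℝ) : Convex ℝ (c.strip k δ) := by
  rintro x ⟨hx1, hx2, hx3⟩ y ⟨hy1, hy2, hy3⟩ a b ha hb hab
  simp only [strip, Set.mem_ofPred_eq, c.combo_sub_div k x y hab, Complex.add_re, Complex.add_im,
    Complex.re_ofReal_mul, Complex.im_ofReal_mul]
  obtain rfl : a = 1 - b := by linarith
  refine ⟨?_, ?_, ?_⟩ <;> rcases hb.eq_or_lt with rfl | hb' <;> first | linarith | nlinarith

/-- One side of the half-strip around a cut. -/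
def sideStrip (k : Fin n) (δ s : ℝ) : Set ℂ := c.strip k δ ∩ {w | 0 < s * ((w - u k) / c.dir).im}

theorem isOpen_sideStrip (k : Fin n) (δ s : ℝ) : IsOpen (c.sideStrip k δ s) := by
  have hc : Continuous fun z : ℂ => (z - u k) / c.dir := by fun_prop
  exact (c.isOpen_strip k δ).inter (isOpen_lt continuous_const
    (continuous_const.mul (Complex.continuous_im.comp hc)))

theorem convex_sideStrip (k : Fin n) (δ s : ℝ) : Convex ℝ (c.sideStrip k δ s) := by
  refine (c.convex_strip k δ).inter ?_
  intro x hx y hy a b ha hb hab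
  simp only [Set.mem_ofPred_eq] at *
  rw [c.combo_sub_div k x y hab]
  simp only [Complex.add_im, Complex.im_ofReal_mul]
  obtain rfl : a = 1 - b := by linarith
  rcases hb.eq_or_lt with rfl | hb' <;> first | linarith | nlinarith

/-- A thin half-strip around a cut contains no pole and meets no other cut. -/
theorem exists_strip (k : Fin n) : ∃ δ > 0, (∀ z ∈ c.strip k δ, ∀ j, z ≠ u j) ∧
    ∀ z ∈ c.strip k δ, z ∈ c.domain ↔ ((z - u k) / c.dir).im ≠ 0 := by
  -- If two poles lay on a common line parallel to `dir`, one of them would lie on the cut of the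
  -- other.
  have him : ∀ j, j ≠ k → ((u j - u k) / c.dir).im ≠ 0 := by
    intro j hj h0
    rcases le_total 0 ((u j - u k) / c.dir).re with h | h
    · obtain ⟨t, ht, h⟩ := (c.mem_cut_iff k (u j)).2 ⟨h0, h⟩
      exact c.generic j k hj t ht h
    · have h1 : (u k - u j) / c.dir = -((u j - u k) / c.dir) := by ring
      obtain ⟨t, ht, h⟩ := (c.mem_cut_iff j (u k)).2 (by
        rw [h1, Complex.neg_im, Complex.neg_re, h0]
        exact ⟨neg_zero, by linarith⟩)
      exact c.generic k j (Ne.symm hj) t ht h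
  have hev : ∀ᶠ δ : ℝ in 𝓝[>] 0, ∀ j, j ≠ k → δ < |((u j - u k) / c.dir).im| := by
    rw [eventually_all]
    intro j
    by_cases hj : j = k
    · simp [hj]
    · filter_upwards [Ioo_mem_nhdsGT (abs_pos.2 (him j hj))] with δ hδ _ using hδ.2
  obtain ⟨δ, hδ, hδ0⟩ := (hev.and self_mem_nhdsWithin).exists
  have hne : ∀ z ∈ c.strip k δ, ∀ j, j ≠ k → ((z - u j) / c.dir).im ≠ 0 := by
    intro z hz j hj h0
    have h1 : ((z - u k) / c.dir).im = ((u j - u k) / c.dir).im := by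
      have : (z - u k) / c.dir = (z - u j) / c.dir + (u j - u k) / c.dir := by ring
      rw [this, Complex.add_im, h0, zero_add]
    have h2 := hδ j hj
    rw [← h1] at h2
    obtain ⟨h3, h4, -⟩ := hz
    exact absurd h2 (not_lt.2 (abs_le.2 ⟨by linarith, h3.le⟩))
  refine ⟨δ, hδ0, fun z hz j => ?_, fun z hz => ?_⟩
  · by_cases hj : j = k
    · rintro rfl
      obtain ⟨-, -, h⟩ := hz
      simp [hj] at h
    · rintro rfl
      exact hne _ hz j hj (by simp)
  · rw [mem_domain_iff]
    constructor
    · intro h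
      rcases h k with h | h
      · exact h
      · exact absurd h (not_lt.2 hz.2.2.le)
    · intro h j
      by_cases hj : j = k
      · exact Or.inl (hj ▸ h)
      · exact Or.inl (hne z hz j hj)

end BranchCuts

/-! ### The quotient of two fundamental matrices and the converse direction. -/

namespace FuchsianSystem

variable {n m : ℕ} {u : Fin n → ℂ} {S₁ S₂ : FuchsianSystem m u} {c : BranchCuts u}
  {T₁ T₂ : ℂ → Matrix (Fin m) (Fin m) ℂ}

/-- The quotient of two fundamental matrices on one side of a cut, in terms of solutions on a
half-strip around the cut. -/
theorem exists_const_on_sideStrip (hT₁ : S₁.IsFundamental c T₁) (hT₂ : S₂.IsFundamental c T₂)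
    {k : Fin n} {δ : ℝ} (hδ : ∀ z ∈ c.strip k δ, z ∈ c.domain ↔ ((z - u k) / c.dir).im ≠ 0)
    {X₁ X₂ : ℂ → Matrix (Fin m) (Fin m) ℂ}
    (hX₁ : ∀ z ∈ c.strip k δ, HasDerivAt X₁ (S₁.coeff z * X₁ z) z)
    (hX₂ : ∀ z ∈ c.strip k δ, HasDerivAt X₂ (S₂.coeff z * X₂ z) z)
    (hX₂u : ∀ z ∈ c.strip k δ, IsUnit (X₂ z)) (s : ℝ) :
    ∃ N : Matrix (Fin m) (Fin m) ℂ, ∀ z ∈ c.sideStrip k δ s,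
      T₂ z * Ring.inverse (T₁ z) * X₁ z = X₂ z * N := by
  rw [isFundamental_iff] at hT₁ hT₂
  have hsub : ∀ z ∈ c.sideStrip k δ s, z ∈ c.domain := fun z hz =>
    (hδ z hz.1).2 fun h0 => by
      have := hz.2
      simp only [Set.mem_ofPred_eq, h0, mul_zero, lt_self_iff_false] at this
  have hopen := c.isOpen_sideStrip k δ s
  have hconn := (c.convex_sideStrip k δ s).isPreconnected
  obtain ⟨K, hK⟩ := exists_eq_mul_of_solutions hopen hconn (fun z hz => hT₁.1 z (hsub z hz))
    (fun z hz => hT₁.2 z (hsub z hz)) (fun z hz => hX₁ z hz.1)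
  obtain ⟨M, hM⟩ := exists_eq_mul_of_solutions hopen hconn (fun z hz => hX₂ z hz.1)
    (fun z hz => hX₂u z hz.1) (fun z hz => hT₂.1 z (hsub z hz))
  refine ⟨M * K, fun z hz => ?_⟩
  rw [hK z hz, mul_assoc, ← mul_assoc (Ring.inverse _),
    Ring.inverse_mul_cancel _ (hT₁.2 z (hsub z hz)), one_mul, hM z hz, mul_assoc]

/-- If the quotient of two fundamental matrices is analytic at `uₖ`, then it extends analytically
across the cut starting at `uₖ`. -/
theorem exists_analyticAt_quotient_of_mem_cut (hT₁ : S₁.IsFundamental c T₁)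
    (hT₂ : S₂.IsFundamental c T₂) {k : Fin n} {F : ℂ → Matrix (Fin m) (Fin m) ℂ}
    (hF : AnalyticAt ℂ F (u k))
    (hTF : ∀ᶠ z in 𝓝[c.domain] (u k), T₂ z * Ring.inverse (T₁ z) = F z) {p : ℂ}
    (hp : p ∈ c.cut k) (hpk : p ≠ u k) :
    ∃ H : ℂ → Matrix (Fin m) (Fin m) ℂ, AnalyticAt ℂ H p ∧
      ∀ᶠ z in 𝓝[c.domain] p, T₂ z * Ring.inverse (T₁ z) = H z := by
  have hd := c.dir_ne_zero
  obtain ⟨δ, hδ0, hpole, hδ⟩ := c.exists_strip k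
  have hmem : ∀ t : ℝ, 0 < t → u k + t * c.dir ∈ c.strip k δ := by
    intro t ht
    simp only [BranchCuts.strip, Set.mem_ofPred_eq, add_sub_cancel_left,
      mul_div_cancel_right₀ _ hd, Complex.ofReal_im, Complex.ofReal_re, neg_zero]
    exact ⟨hδ0, hδ0, ht⟩
  have hps : p ∈ c.strip k δ := by
    obtain ⟨t, ht, rfl⟩ := hp
    rcases ht.eq_or_lt with rfl | ht'
    · simp at hpk
    · exact hmem t ht'
  have hopen := c.isOpen_strip k δ
  have hconv := c.convex_strip k δ
  obtain ⟨X₁, -, hX₁, hX₁u⟩ := exists_isUnit_solution hopen hconv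
    (S₁.differentiableOn_coeff hpole) hps
  obtain ⟨X₂, -, hX₂, hX₂u⟩ := exists_isUnit_solution hopen hconv
    (S₂.differentiableOn_coeff hpole) hps
  choose N hN using exists_const_on_sideStrip hT₁ hT₂ hδ hX₁ hX₂ hX₂u
  obtain ⟨ε, hε, hball⟩ := Metric.eventually_nhds_iff_ball.1
    (hF.eventually_analyticAt.and (eventually_nhdsWithin_iff.1 hTF))
  obtain ⟨q, hqs, hqb, hq0⟩ : ∃ q ∈ c.strip k δ, q ∈ Metric.ball (u k) ε ∧
      ((q - u k) / c.dir).im = 0 := by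
    have h1 : Tendsto (fun t : ℝ => u k + t * c.dir) (𝓝[>] 0) (𝓝 (u k)) := by
      have : Continuous fun t : ℝ => u k + t * c.dir := by fun_prop
      exact (this.tendsto' 0 _ (by simp)).mono_left nhdsWithin_le_nhds
    obtain ⟨t, ht1, ht2⟩ := ((h1.eventually_mem (Metric.ball_mem_nhds _ hε)).and
      self_mem_nhdsWithin).exists
    exact ⟨_, hmem t ht2, ht1, by simp [hd]⟩
  -- `q` lies on the cut, so close to `u k` that the quotient is known to be analytic there.
  -- Approaching `q` from the two sides, `s = 1` and `s = -1`, forces the two constants to coincide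
  -- along the whole cut.
  have hlim : ∀ s : ℝ, s ≠ 0 → F q * X₁ q = X₂ q * N s := by
    intro s hs
    have hγ : Tendsto (fun τ : ℝ => q + s * τ * Complex.I * c.dir) (𝓝[>] 0) (𝓝 q) := by
      have : Continuous fun τ : ℝ => q + s * τ * Complex.I * c.dir := by fun_prop
      exact (this.tendsto' 0 _ (by simp)).mono_left nhdsWithin_le_nhds
    have h1 : Tendsto (fun z => F z * X₁ z) (𝓝 q) (𝓝 (F q * X₁ q)) :=
      ((hball q hqb).1.continuousAt.mul (hX₁ q hqs).continuousAt).tendsto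
    have h2 : Tendsto (fun z => X₂ z * N s) (𝓝 q) (𝓝 (X₂ q * N s)) :=
      ((hX₂ q hqs).continuousAt.mul continuousAt_const).tendsto
    refine tendsto_nhds_unique ((h1.comp hγ).congr' ?_) (h2.comp hγ)
    filter_upwards [hγ.eventually_mem (hopen.mem_nhds hqs),
      hγ.eventually_mem (Metric.isOpen_ball.mem_nhds hqb), self_mem_nhdsWithin] with τ h3 h4 h5
    have h6 : ((q + s * τ * Complex.I * c.dir - u k) / c.dir).im = s * τ := by
      have : (q + s * τ * Complex.I * c.dir - u k) / c.dir =
          (q - u k) / c.dir + ((s * τ : ℝ) : ℂ) * Complex.I := by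
        push_cast
        field_simp
        ring
      rw [this, Complex.add_im, hq0]
      simp
    have hτ : (0 : ℝ) < τ := h5
    have h7 : q + s * τ * Complex.I * c.dir ∈ c.sideStrip k δ s := by
      refine ⟨h3, ?_⟩
      rw [Set.mem_ofPred_eq, h6, ← mul_assoc, ← sq]
      positivity
    have h8 := hN s _ h7
    rw [(hball _ h4).2 ((hδ _ h3).2 (by rw [h6]; exact mul_ne_zero hs hτ.ne'))] at h8
    exact h8
  have hNeq : N (-1) = N 1 := (hX₂u q hqs).mul_left_cancel
    ((hlim (-1) (by norm_num)).symm.trans (hlim 1 one_ne_zero))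
  refine ⟨fun z => X₂ z * N 1 * Ring.inverse (X₁ z), ?_, ?_⟩
  · rw [Complex.analyticAt_iff_eventually_differentiableAt]
    filter_upwards [hopen.mem_nhds hps] with z hz
    exact ((hX₂ z hz).differentiableAt.mul_const _).mul
      ((hX₁ z hz).ringInverse_solution (hX₁u z hz)).differentiableAt
  · filter_upwards [self_mem_nhdsWithin, nhdsWithin_le_nhds (hopen.mem_nhds hps)] with z hz hzs
    have h1 : T₂ z * Ring.inverse (T₁ z) * X₁ z = X₂ z * N 1 := by
      rcases lt_or_gt_of_ne ((hδ z hzs).1 hz) with h | h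
      · rw [← hNeq]
        exact hN (-1) z ⟨hzs, by simpa using h⟩
      · exact hN 1 z ⟨hzs, by simpa using h⟩
    rw [← h1, mul_assoc _ (X₁ z), Ring.mul_inverse_cancel _ (hX₁u z hzs), mul_one]

/-- If the quotient of fundamental matrices is analytic at all poles and at infinity, then it is
constant. -/
theorem quotient_eq_const (hT₁ : S₁.IsFundamental c T₁) (hT₂ : S₂.IsFundamental c T₂)
    (hpole : ∀ k, ∃ F : ℂ → Matrix (Fin m) (Fin m) ℂ, AnalyticAt ℂ F (u k) ∧
      ∀ᶠ z in 𝓝[c.domain] (u k), T₂ z * Ring.inverse (T₁ z) = F z)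
    {H : ℂ → Matrix (Fin m) (Fin m) ℂ} (hH : AnalyticAt ℂ H 0) {r : ℝ}
    (hinf : ∀ z ∈ c.lowerHalf r, z ∈ c.domain → T₂ z * Ring.inverse (T₁ z) = H z⁻¹) :
    ∀ z ∈ c.domain, T₂ z * Ring.inverse (T₁ z) = H 0 := by
  have hT₁' := (isFundamental_iff _ _ _).1 hT₁
  have hT₂' := (isFundamental_iff _ _ _).1 hT₂
  obtain ⟨F, hF, hTF⟩ := c.dense_domain.exists_entire_extension
    (Y := fun z => T₂ z * Ring.inverse (T₁ z)) (by
      intro p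
      by_cases hp : p ∈ c.domain
      · refine ⟨fun z => T₂ z * Ring.inverse (T₁ z), ?_, Eventually.of_forall fun _ => rfl⟩
        rw [Complex.analyticAt_iff_eventually_differentiableAt]
        filter_upwards [c.isOpen_domain.mem_nhds hp] with z hz
        exact (hT₂'.1 z hz).differentiableAt.mul
          ((hT₁'.1 z hz).ringInverse_solution (hT₁'.2 z hz)).differentiableAt
      · obtain ⟨k, hk⟩ : ∃ k, p ∈ c.cut k := by
          by_contra h
          exact hp fun k hk => h ⟨k, hk⟩
        obtain ⟨F, hF, hTF⟩ := hpole k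
        by_cases hpk : p = u k
        · exact ⟨F, hpk ▸ hF, hpk ▸ hTF⟩
        · exact exists_analyticAt_quotient_of_mem_cut hT₁ hT₂ hF hTF hk hpk)
  intro z hz
  refine (hTF z hz).trans (hF.eq_const_of_eq_comp_inv hH (fun ρ => ?_) z)
  obtain ⟨r₀, hr₀⟩ := c.exists_lowerHalf_subset
  have hd : 0 < ‖c.dir‖ := norm_pos_iff.2 c.dir_ne_zero
  set r' := max r (max r₀ (ρ / ‖c.dir‖)) with hr'
  obtain ⟨t, -, ht⟩ := c.exists_sub_mem_lowerHalf 0 r'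
  have hρ : ρ ≤ r' * ‖c.dir‖ := by
    rw [← div_le_iff₀ hd]
    exact (le_max_right _ _).trans (le_max_right _ _)
  refine ⟨_, hρ.trans_lt (c.norm_lt_of_mem_lowerHalf ht), ?_⟩
  filter_upwards [(c.isOpen_lowerHalf r').mem_nhds ht] with w hw
  have hwd : w ∈ c.domain := hr₀ r' ((le_max_left _ _).trans (le_max_right _ _)) hw
  rw [← hTF w hwd]
  refine hinf w ?_ hwd
  simp only [BranchCuts.lowerHalf, Set.mem_ofPred_eq] at hw ⊢
  linarith [le_max_left r (max r₀ (ρ / ‖c.dir‖))]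

/-- A sum of simple fractions vanishing on the plane without the cuts has zero residues. -/
theorem residue_eq_zero (hu : Function.Injective u) {X : Fin n → Matrix (Fin m) (Fin m) ℂ}
    (h : ∀ z ∈ c.domain, ∑ k, (z - u k)⁻¹ • X k = 0) (k : Fin n) : X k = 0 := by
  -- This is `(z - u k)` times the sum, with the pole at `u k` removed; it is continuous there with
  -- value `X k`.
  set L : ℂ → Matrix (Fin m) (Fin m) ℂ := fun z =>
    X k + (z - u k) • ∑ j ∈ Finset.univ.erase k, (z - u j)⁻¹ • X j with hL
  have hcont : ContinuousAt L (u k) := by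
    refine continuousAt_const.add (ContinuousAt.smul (f := fun z : ℂ => z - u k) (by fun_prop) ?_)
    refine tendsto_finsetSum _ fun j hj => ?_
    have hne : u k - u j ≠ 0 := sub_ne_zero.2 fun h => Finset.ne_of_mem_erase hj (hu h).symm
    exact (ContinuousAt.inv₀ (f := fun z : ℂ => z - u j) (by fun_prop) hne).smul continuousAt_const
  have hzero : ∀ z ∈ c.domain, L z = 0 := by
    intro z hz
    have hne : z - u k ≠ 0 := sub_ne_zero.2 (c.ne_of_mem_domain hz k)
    have h1 := congrArg (fun Y => (z - u k) • Y) (h z hz)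
    simp only [smul_zero] at h1
    rw [← Finset.add_sum_erase _ _ (Finset.mem_univ k), smul_add, smul_smul,
      mul_inv_cancel₀ hne, one_smul] at h1
    exact h1
  have : (𝓝[c.domain] (u k)).NeBot := mem_closure_iff_nhdsWithin_neBot.1 (c.dense_domain (u k))
  have h2 : L (u k) = 0 := by
    refine tendsto_nhds_unique (l := 𝓝[c.domain] (u k))
      (hcont.tendsto.mono_left nhdsWithin_le_nhds)
      (tendsto_const_nhds.congr' ?_)
    filter_upwards [self_mem_nhdsWithin] with z hz
    exact (hzero z hz).symm
  simpa [hL] using h2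

/-- A constant quotient of fundamental matrices intertwines the residue matrices. -/
theorem mul_eq_mul_of_quotient_const (hu : Function.Injective u) (hT₁ : S₁.IsFundamental c T₁)
    (hT₂ : S₂.IsFundamental c T₂) {M : Matrix (Fin m) (Fin m) ℂ}
    (hM : ∀ z ∈ c.domain, T₂ z * Ring.inverse (T₁ z) = M) :
    IsUnit M ∧ ∀ k, S₂.A k * M = M * S₁.A k := by
  rw [isFundamental_iff] at hT₁ hT₂
  have hT : ∀ z ∈ c.domain, T₂ z = M * T₁ z := by
    intro z hz
    rw [← hM z hz, mul_assoc, Ring.inverse_mul_cancel _ (hT₁.2 z hz), mul_one]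
  constructor
  · obtain ⟨z, hz⟩ := c.domain_nonempty
    rw [← hM z hz]
    exact (hT₂.2 z hz).mul (hT₁.2 z hz).ringInverse
  intro k
  rw [← sub_eq_zero]
  refine residue_eq_zero (c := c) hu (X := fun k => S₂.A k * M - M * S₁.A k) (fun z hz => ?_) k
  have h1 : HasDerivAt T₂ (M * (S₁.coeff z * T₁ z)) z := by
    refine ((hT₁.1 z hz).const_mul M).congr_of_eventuallyEq ?_
    filter_upwards [c.isOpen_domain.mem_nhds hz] with w hw using hT w hw
  have h2 := (hT₂.1 z hz).unique h1
  rw [hT z hz, ← mul_assoc, ← mul_assoc] at h2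
  have h3 := (hT₁.2 z hz).mul_right_cancel h2
  have h4 : S₂.coeff z * M - M * S₁.coeff z = 0 := sub_eq_zero.2 h3
  simp only [coeff, Finset.sum_mul, Finset.mul_sum, ← Finset.sum_sub_distrib, smul_mul_assoc,
    mul_smul_comm, ← smul_sub] at h4
  exact h4

/-- Systems that realize equivalent collections are conjugate by a diagonal matrix. -/
theorem Realizes.exists_diagonal_conj (hu : Function.Injective u)
    {d₁ d₂ : MonodromyCollection n m} (h₁ : S₁.Realizes c d₁) (h₂ : S₂.Realizes c d₂)
    (heq : d₂.Equivalent d₁) :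
    ∃ g : Fin m → ℂ, (∀ i, g i ≠ 0) ∧
      ∀ k, S₂.A k = (diagonal g)⁻¹ * S₁.A k * diagonal g := by
  obtain ⟨G, GI, hG, hGI, hlam, hlamInf, hR, hRInf, hC⟩ := heq
  obtain ⟨hlam₁, Φ₁, ΦI₁, hΦ₁, ⟨hf₁, -, Ψ₁, hΨ₁, hΨ₁0, r₁, hr₁⟩, hC₁⟩ := h₁
  obtain ⟨hlam₂, Φ₂, ΦI₂, hΦ₂, ⟨hf₂, -, Ψ₂, hΨ₂, hΨ₂0, r₂, hr₂⟩, hC₂⟩ := h₂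
  rw [← Matrix.analyticAt_iff_entries] at hΨ₁ hΨ₂
  have hT₂ := hf₂.mul_isUnit GI.isUnit
  have hf₁' := (isFundamental_iff _ _ _).1 hf₁
  have hquot : ∀ z ∈ c.domain, ∀ M, ΦI₂ z * GI.val = M * ΦI₁ z →
      ΦI₂ z * GI.val * Ring.inverse (ΦI₁ z) = M := by
    intro z hz M hM
    rw [hM, mul_assoc, Ring.mul_inverse_cancel _ (hf₁'.2 z hz), mul_one]
  have hpole : ∀ k, ∃ F : ℂ → Matrix (Fin m) (Fin m) ℂ, AnalyticAt ℂ F (u k) ∧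
      ∀ᶠ z in 𝓝[c.domain] (u k), ΦI₂ z * GI.val * Ring.inverse (ΦI₁ z) = F z := by
    intro k
    obtain ⟨-, -, X, hX, hXdet, hXev⟩ := hΦ₁ k
    obtain ⟨-, -, Y, hY, -, hYev⟩ := hΦ₂ k
    rw [← Matrix.analyticAt_iff_entries] at hX hY
    obtain ⟨P, hP, -, hPexp⟩ := (hG k).exists_polynomial_conj
    have hXu : IsUnit (X (u k)) := (Matrix.isUnit_iff_isUnit_det _).2 hXdet.isUnit
    have hXev' : ∀ᶠ z in 𝓝 (u k), IsUnit (X z) :=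
      hX.continuousAt.eventually_mem (Units.isOpen.mem_nhds hXu)
    -- Rewriting `Φ_∞` through `Φₖ` on both sides turns the quotient into that of `Φₖ⁽²⁾Gₖ` by
    -- `Φₖ⁽¹⁾`; the common matrix `d₁.C k` drops out, and `levelt_quotient` gives this formula.
    refine ⟨fun z => Y z * P (z - u k) * Ring.inverse (X z),
      (hY.mul ((hP.comp (differentiable_id.sub_const (u k))).analyticAt _)).mul
        (hX.ringInverse hXu), ?_⟩
    filter_upwards [hXev, hYev, nhdsWithin_le_nhds hXev', self_mem_nhdsWithin] with z h1 h2 h3 hz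
    refine hquot z hz _ ?_
    have hexp : Complex.exp (c.logAt k z) = z - u k :=
      c.exp_clog _ (sub_ne_zero.2 (c.ne_of_mem_domain hz k))
    have h4 := levelt_quotient (R := d₂.R k) (Y := Y z) h3 (hPexp (c.logAt k z))
    rw [← h2, hexp, ← hR k, ← hlam, ← h1] at h4
    have h5 : d₂.C k * GI.val = (G k).val * d₁.C k := by
      rw [hC k, ← mul_assoc, ← mul_assoc, ← Units.val_mul, mul_inv_cancel, Units.val_one, one_mul]
    rw [hC₂ k z hz, hC₁ k z hz, mul_assoc, h5, ← mul_assoc, h4, mul_assoc]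
  obtain ⟨P, hP, hP0, hPexp⟩ := hGI.exists_polynomial_conj
  have hΨ₁u : IsUnit (Ψ₁ 0) := by
    rw [hΨ₁0]
    exact isUnit_one
  obtain ⟨ρ, hρ⟩ : ∃ ρ : ℝ, ∀ z ∈ c.lowerHalf ρ, z ≠ 0 ∧ IsUnit (Ψ₁ z⁻¹) := by
    obtain ⟨ε, hε, hball⟩ := Metric.eventually_nhds_iff.1
      (hΨ₁.continuousAt.eventually_mem (Units.isOpen.mem_nhds hΨ₁u))
    have hd : 0 < ‖c.dir‖ := norm_pos_iff.2 c.dir_ne_zero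
    refine ⟨ε⁻¹ / ‖c.dir‖, fun z hz => ?_⟩
    have h1 := c.norm_lt_of_mem_lowerHalf hz
    rw [div_mul_cancel₀ _ hd.ne'] at h1
    refine ⟨norm_pos_iff.1 ((inv_pos.2 hε).trans h1), hball ?_⟩
    rw [dist_zero_right, norm_inv]
    exact inv_lt_of_inv_lt₀ hε h1
  have hconst := quotient_eq_const hf₁ hT₂ hpole
    (H := fun w => Ψ₂ w * P w * Ring.inverse (Ψ₁ w))
    ((hΨ₂.mul (hP.analyticAt 0)).mul (hΨ₁.ringInverse hΨ₁u)) (r := max ρ (max r₁ r₂)) (by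
      intro z hz hzd
      have hz' : (z / c.dir).re < -max ρ (max r₁ r₂) := hz
      have hρz : ρ ≤ max ρ (max r₁ r₂) := le_max_left _ _
      have hz1 : r₁ ≤ max ρ (max r₁ r₂) := (le_max_left _ _).trans (le_max_right _ _)
      have hz2 : r₂ ≤ max ρ (max r₁ r₂) := (le_max_right _ _).trans (le_max_right _ _)
      obtain ⟨hz0, hzu⟩ := hρ z (by simp only [BranchCuts.lowerHalf, Set.mem_ofPred_eq]; linarith)
      refine hquot z hzd _ ?_
      have hexp : Complex.exp (-c.logInf z) = z⁻¹ := by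
        rw [Complex.exp_neg, BranchCuts.logInf, c.exp_clog _ hz0]
      have h4 := levelt_quotient (R := d₂.RInf) (Y := Ψ₂ z⁻¹) hzu (hPexp (-c.logInf z))
      rw [← hr₂ z (by linarith), hexp, ← hRInf, ← hlamInf, ← hr₁ z (by linarith)] at h4
      exact h4)
  simp only [hΨ₁0, hΨ₂0, one_mul, Ring.inverse_one, mul_one] at hconst
  obtain ⟨hPu, hPA⟩ := mul_eq_mul_of_quotient_const hu hf₁ hT₂ hconst
  have hinj : Function.Injective d₂.lamInf := by
    rw [hlam₂]
    exact S₂.distinct_inf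
  -- The constant quotient is `P 0`, as both `Ψ` are `1` at infinity. Distinctness of the entries of
  -- `A_∞` leaves no off-diagonal entry.
  obtain ⟨h, hPh⟩ : ∃ h : Fin m → ℂ, P 0 = diagonal h := ⟨(P 0).diag, by
    ext i j
    by_cases hij : i = j
    · simp [hij]
    · rw [Matrix.diagonal_apply_ne _ hij, hP0 i j (hinj.ne hij)]⟩
  rw [hPh] at hPu hPA
  have hne : ∀ i, h i ≠ 0 := by
    have := ((Matrix.isUnit_iff_isUnit_det _).1 hPu).ne_zero
    rw [Matrix.det_diagonal, Finset.prod_ne_zero_iff] at this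
    exact fun i => this i (Finset.mem_univ i)
  have hinv : diagonal h * diagonal (fun i => (h i)⁻¹) = 1 := by
    simp [Matrix.diagonal_mul_diagonal, hne]
  refine ⟨fun i => (h i)⁻¹, fun i => inv_ne_zero (hne i), fun k => ?_⟩
  rw [Matrix.inv_eq_left_inv hinv, ← hPA k, mul_assoc, hinv, mul_one]

end FuchsianSystem

end

theorem lemma2p1 {n m : ℕ} (u : Fin n → ℂ) (hu : Function.Injective u)
    (S₁ S₂ : FuchsianSystem m u) (hInf : S₁.AInf = S₂.AInf) (c : BranchCuts u)
    (lam : Fin n → Fin m → ℂ) (hlam : S₁.IsEigenvalueOrdering lam) :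
    (∃ g : Fin m → ℂ, (∀ i, g i ≠ 0) ∧
      ∀ k, S₂.A k = (Matrix.diagonal g)⁻¹ * S₁.A k * Matrix.diagonal g) ↔
    (S₂.IsEigenvalueOrdering lam ∧ S₁.monodromyData c lam = S₂.monodromyData c lam) := by
  constructor
  · rintro ⟨g, hg, hA⟩
    have hD : (diagonalUnit g hg).val = diagonal g := rfl
    have hD' : ((diagonalUnit g hg)⁻¹).val = diagonal fun i => (g i)⁻¹ := rfl
    have h12 : ∀ k, S₂.A k = ((diagonalUnit g hg)⁻¹).val * S₁.A k * (diagonalUnit g hg).val := by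
      intro k
      rw [hA k, Matrix.coe_units_inv, hD]
    have h21 : ∀ k, S₁.A k =
        (((diagonalUnit g hg)⁻¹)⁻¹).val * S₂.A k * ((diagonalUnit g hg)⁻¹).val := by
      intro k
      rw [h12 k]
      simp only [inv_inv, mul_assoc, Units.mul_inv, mul_one, Units.mul_inv_cancel_left]
    exact ⟨FuchsianSystem.isEigenvalueOrdering_of_conj h12 hlam, Set.Subset.antisymm
      (FuchsianSystem.monodromyData_subset_of_conj h12 hD hD' hInf c lam)
      (FuchsianSystem.monodromyData_subset_of_conj h21 hD' (by rw [inv_inv]; exact hD)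
        hInf.symm c lam)⟩
  · rintro ⟨-, hdata⟩
    -- A collection read off the first system lies in its own class, hence in that of the second,
    -- where it is equivalent to one read off the second system.
    obtain ⟨d₁, hd₁, hr₁⟩ := S₁.exists_realizes hu c hlam
    have hmem : d₁ ∈ S₁.monodromyData c lam :=
      ⟨d₁, hd₁, hr₁, MonodromyCollection.Equivalent.refl d₁⟩
    rw [hdata] at hmem
    obtain ⟨d₂, -, hr₂, heq⟩ := hmem
    exact hr₁.exists_diagonal_conj hu hr₂ heq
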